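/- Consider $N$ alternatives with unknown means $\mu^{true}_1,\dots,\mu^{true}_N$, which are independent with arbitrary prior laws $\nu_1,\dots,\nu_N$ on $\mathbb R$; almost surely there is a unique best alternative $\arg\max_i\mu_i^{true}$. Given the means, the successive observations of alternative $i$ are i.i.d. $N(\mu_i^{true},(\sigma_i^{true})^2)$ with known $(\sigma_i^{true})^2>0$, independently over the alternatives. For a total budget $T$, let $s_t$ denote the state after $t$ observations have been allocated: the number of observations, the sample mean and the sample variance of each alternative (which determine the posterior), and the remaining budget $T-t$. Fix a base policy $\pi$ (a possibly randomized rule that chooses the next alternative from the state), a number of rollouts $K\ge1$, and a lookahead $H\in\{1,2,\dots\}\cup\{\infty\}$. In state $s_t$, the value $Q(s_t,i)$ is the probability of a correct final selection when alternative $i$ is sampled next, the following $\min(H,T-t)-1$ observations are allocated by $\pi$, the means have their posterior law at $s_t$ and the observations are drawn from the predictive laws. The rollout policy draws, independently of the true observations, independent Bernoulli rewards $r^{(i)}_{t,k}$, $1\le i\le N$, $1\le k\le K$, with parameters $Q(s_t,i)$, and allocates observation $t+1$ to an alternative $a^{roll}_{t+1}$ that maximizes the average reward $\frac1K\sum_k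 r^{(i)}_{t,k}$; ties are broken by a fixed rule, which gives positive probability to each of the tied alternatives (for instance, uniformly at random). If $H<\infty$, the tie-breaking rule may be arbitrary, e.g. deterministic. The final selection $S_T^{roll}(s_T)$, and likewise the selection at the end of each rollout, is an alternative with the largest posterior probability of being the best; if all $\nu_i$ are normal, it may instead be an alternative with the largest posterior mean. The runs with budgets $T=1,2,\dots$ use the same means and the same sequences of observations of each alternative. Let $\Pr^{improve}(s_t)$ be the conditional probability given $s_t$ that $a^{roll}_{t+1}\in\arg\max_iQ(s_t,i)$, and assume, almost surely: (a) for every alternative $i$, every $x\in\mathbb R$ and every $n\in\mathbb N$ there is $\epsilon>0$ such that $\epsilon<\Pr(\mu_i^{true}>x\mid s_T)<1-\epsilon$ for all budgets $T$ for which alternative $i$ is sampled at most $n$ times; (b) for all sufficiently large $t$ and all budgets $T>t$, $\Pr^{improve}(s_t)>0$. Then the rollout policy is consistent: $$\lim_{T\to\infty}S_T^{roll}(s_T)=\arg\max_{i=1,\dots,N}\mu_i^{true}\quad\text{a.s.}$$ -/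

import Mathlib

open MeasureTheory ProbabilityTheory Filter Topology
open scoped NNReal ENNReal

noncomputable section

namespace RankingSelection

/-- A Bayesian ranking-and-selection problem with `N` alternatives: the means are independent,
the mean of alternative `i` has prior law `prior i`, and an observation of alternative `i` is
normal with that mean and with known variance `obsVar i > 0`. -/
structure Problem (N : ℕ) where
  prior : Fin N → Measure ℝ
  isProb : ∀ i, IsProbabilityMeasure (prior i)
  obsVar : Fin N → ℝ≥0
  obsVar_ne_zero : ∀ i, obsVar i ≠ 0

/-- The statistics of the observations: for every alternative the number of observations, the
sample mean and the sample variance. Together with the prior they determine the posterior. -/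
abbrev State (N : ℕ) := Fin N → ℕ × ℝ × ℝ

/-- No observation yet. -/
def State.init (N : ℕ) : State N := fun _ => (0, 0, 0)

/-- The statistics after a further observation `x` of alternative `i`; those of the other
alternatives do not change. -/
def State.update {N : ℕ} (s : State N) (i : Fin N) (x : ℝ) : State N :=
  Function.update s i
    ((s i).1 + 1,
     ((s i).1 * (s i).2.1 + x) / ((s i).1 + 1),
     (s i).1 / ((s i).1 + 1) * ((s i).2.2 + ((s i).2.1 - x) ^ 2 / ((s i).1 + 1)))

/-- The statistics after `t` steps, when step `t + 1` samples the alternative `a t`, and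
`y i n` is the `n`-th observation (counted from `0`) of alternative `i`. -/
def stateAfter {N : ℕ} (y : Fin N → ℕ → ℝ) (a : ℕ → Fin N) : ℕ → State N
  | 0 => State.init N
  | t + 1 =>
      (stateAfter y a t).update (a t) (y (a t) ((stateAfter y a t) (a t)).1)

/-- The indices at which `f` is maximal. -/
def argmaxSet {N : ℕ} (f : Fin N → ℝ) : Finset (Fin N) :=
  open Classical in Finset.univ.filter (fun i => ∀ j, f j ≤ f i)

namespace Problem

variable {N : ℕ} (M : Problem N)

/-- The posterior law of the mean of alternative `i`, by Bayes' rule: the likelihood of `n` normal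
observations with sample mean `m` is, as a function of `θ`, proportional to
`exp (- n (m - θ)² / (2 σ²))`. -/
def post (s : State N) (i : Fin N) : Measure ℝ :=
  (M.prior i).tilted (fun θ => -((s i).1 * ((s i).2.1 - θ) ^ 2) / (2 * M.obsVar i))

/-- The joint posterior law of the means. -/
def posterior (s : State N) : Measure (Fin N → ℝ) := Measure.pi (fun i => M.post s i)

/-- The posterior probability that alternative `i` is a best one. -/
def probBest (s : State N) (i : Fin N) : ℝ := (M.posterior s).real {θ | ∀ j, θ j ≤ θ i}

/-- The posterior mean of the mean of alternative `i`. -/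
def postMean (s : State N) (i : Fin N) : ℝ := ∫ θ, θ ∂(M.post s i)

/-- The selection of an alternative with the largest posterior probability of being the best. -/
def SelectsMaxProb (sel : State N → Fin N) : Prop :=
  ∀ s j, M.probBest s j ≤ M.probBest s (sel s)

/-- The selection of an alternative with the largest posterior mean. -/
def SelectsMaxMean (sel : State N → Fin N) : Prop :=
  ∀ s j, M.postMean s j ≤ M.postMean s (sel s)

/-- All priors are normal (the conjugate case). -/
def NormalPriors : Prop :=
  ∃ (m₀ : Fin N → ℝ) (v₀ : Fin N → ℝ≥0), ∀ i, M.prior i = gaussianReal (m₀ i) (v₀ i)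

end Problem

/-- The design of a rollout policy. -/
structure Design (N : ℕ) where
  /-- The base policy, possibly randomized: given the number of observations that remain to be
  allocated and the statistics, the law of the next alternative to sample. -/
  base : ℕ → Kernel (State N) (Fin N)
  isMarkov : ∀ m, IsMarkovKernel (base m)
  /-- The final selection. -/
  sel : State N → Fin N
  measurable_sel : Measurable sel
  /-- The number of rollouts for each action. -/
  K : ℕ
  K_pos : 0 < K
  /-- The number of steps that a rollout looks ahead; `⊤` means that it always runs until the
  budget is used up. -/
  H : ℕ∞
  H_pos : 1 ≤ H
  /-- The choice among the alternatives whose estimated action values are tied for the maximum. -/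
  tie : Finset (Fin N) → PMF (Fin N)
  tie_support : ∀ A : Finset (Fin N), A.Nonempty → (tie A).support ⊆ A

namespace Design

variable {N : ℕ} (D : Design N) (M : Problem N)

/-- `PCS^π(s)` with `m` remaining observations: the probability of a correct final selection when
the `m` observations are allocated by the base policy, the means have their posterior law at `s`,
and the observations are drawn from the predictive laws. -/
def pcs : ℕ → State N → ℝ
  | 0, s => M.probBest s (D.sel s)
  | m + 1, s => ∑ i, (D.base (m + 1) s).real {i} *
      ∫ θ, ∫ x, pcs m (s.update i x) ∂(gaussianReal θ (M.obsVar i)) ∂(M.post s i)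

/-- The theoretical value of the action "sample `i`" in `s`, followed by `m` observations that are
allocated by the base policy. -/
def actionValue (m : ℕ) (s : State N) (i : Fin N) : ℝ :=
  ∫ θ, ∫ x, D.pcs M m (s.update i x) ∂(gaussianReal θ (M.obsVar i)) ∂(M.post s i)

/-- With budget `T` and `t` observations already allocated, a rollout generates
`min H (T - t)` observations; this is what remains of them after the first one. -/
def lookahead (T t : ℕ) : ℕ := (min D.H ((T - t : ℕ) : ℕ∞)).toNat - 1

/-- The theoretical action values with which the rollout policy with budget `T` works when `t`
observations have been allocated. -/
def Q (T t : ℕ) (s : State N) : Fin N → ℝ := D.actionValue M (D.lookahead T t) s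

/-- The rewards of the rollouts: `v i k` says whether the final selection in the `k`-th rollout
for action `i` was correct. -/
abbrev Rewards : Type := Fin N → Fin D.K → Bool

/-- The estimated action value: the average reward. -/
def estimate (v : D.Rewards) (i : Fin N) : ℝ := (∑ k, if v i k then (1 : ℝ) else 0) / D.K

/-- The joint law of the rewards: independent Bernoulli variables, those for action `i` with
parameter `q i`. -/
def rewardProb (q : Fin N → ℝ) (v : D.Rewards) : ℝ :=
  ∏ i, ∏ k, if v i k then q i else 1 - q i

/-- The joint probability of the rewards `v` and the action `i`: the action maximizes the estimated
action value, ties being resolved by `tie`. -/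
def stepProb (q : Fin N → ℝ) (v : D.Rewards) (i : Fin N) : ℝ :=
  D.rewardProb q v * (D.tie (argmaxSet (D.estimate v)) i).toReal

/-- The probability of policy improvement in `s`: the probability that the action of the rollout
policy maximizes the theoretical action value. -/
def probImprove (T t : ℕ) (s : State N) : ℝ :=
  ∑ v : D.Rewards, ∑ i ∈ argmaxSet (D.Q M T t s), D.stepProb (D.Q M T t s) v i

end Design

/-- The true means `μ`, together with the successive observations `Y i 0, Y i 1, …` of each
alternative `i`, follow the Bayesian model `M`: the means and the noises `Y i n - μ i` are
independent, with the prior laws and with centred normal laws, respectively. -/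
structure FollowsModel {N : ℕ} (M : Problem N) {Ω : Type*} [MeasurableSpace Ω] (P : Measure Ω)
    (μ : Fin N → Ω → ℝ) (Y : Fin N → ℕ → Ω → ℝ) : Prop where
  measurable_mean : ∀ i, Measurable (μ i)
  measurable_obs : ∀ i n, Measurable (Y i n)
  law_mean : ∀ i, P.map (μ i) = M.prior i
  law_noise : ∀ i n, P.map (fun ω => Y i n ω - μ i ω) = gaussianReal 0 (M.obsVar i)
  indep : iIndepFun
    (fun k : Fin N ⊕ Fin N × ℕ =>
      (Sum.elim μ (fun p ω => Y p.1 p.2 ω - μ p.1 ω) k : Ω → ℝ)) P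

/-- The statistics after `t` steps of the run with budget `T`, whose actions are `a T`. -/
def runState {N : ℕ} {Ω : Type*} (Y : Fin N → ℕ → Ω → ℝ) (a : ℕ → ℕ → Ω → Fin N)
    (T t : ℕ) (ω : Ω) : State N :=
  stateAfter (fun i n => Y i n ω) (fun u => a T u ω) t

/-- The sigma-algebra generated by the means, all observations, and the rewards and actions in the
first `t` steps of the run with budget `T`. -/
@[reducible] def past {N : ℕ} (D : Design N) {Ω : Type*} (μ : Fin N → Ω → ℝ) (Y : Fin N → ℕ → Ω → ℝ)
    (r : ℕ → ℕ → Ω → D.Rewards) (a : ℕ → ℕ → Ω → Fin N) (T t : ℕ) : MeasurableSpace Ω :=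
  MeasurableSpace.comap
    (fun ω => ((fun i => μ i ω), (fun i n => Y i n ω),
      (fun u : Fin t => (r T u ω, a T u ω))))
    (inferInstance : MeasurableSpace
      ((Fin N → ℝ) × (Fin N → ℕ → ℝ) × (Fin t → D.Rewards × Fin N)))

/-- For every budget `T`, `r T t` and `a T t` are the rollout rewards and the action with which
the rollout policy allocates observation `t + 1`. Given the past, their law depends on the
statistics only: the rollouts use simulated observations, independent of the true ones. Nothing is
assumed on the joint law of runs with different budgets, except that they see the same means and
the same observations. -/
structure IsRollout {N : ℕ} (M : Problem N) (D : Design N) {Ω : Type*} [MeasurableSpace Ω]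
    (P : Measure Ω) (μ : Fin N → Ω → ℝ) (Y : Fin N → ℕ → Ω → ℝ)
    (r : ℕ → ℕ → Ω → D.Rewards) (a : ℕ → ℕ → Ω → Fin N) : Prop where
  measurable_rewards : ∀ T t, Measurable (r T t)
  measurable_action : ∀ T t, Measurable (a T t)
  law_step : ∀ T t, t < T → ∀ (v : D.Rewards) (i : Fin N),
    P[Set.indicator {ω | r T t ω = v ∧ a T t ω = i} (fun _ => (1 : ℝ)) | past D μ Y r a T t]
      =ᵐ[P] fun ω => D.stepProb (D.Q M T t (runState Y a T t ω)) v i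

/-- Almost surely, the posterior tail probabilities of an alternative that has been sampled
finitely often stay away from `0` and `1`: the bound may depend on the path, on the alternative,
on the threshold `x` and on the number `n` of samples, but not on the budget. -/
def NondegenerateTails {N : ℕ} (M : Problem N) {Ω : Type*} [MeasurableSpace Ω] (P : Measure Ω)
    (Y : Fin N → ℕ → Ω → ℝ) (a : ℕ → ℕ → Ω → Fin N) : Prop :=
  ∀ᵐ ω ∂P, ∀ (i : Fin N) (x : ℝ) (n : ℕ), ∃ ε : ℝ, 0 < ε ∧
    ∀ T : ℕ, (runState Y a T T ω i).1 ≤ n →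
      ε < (M.post (runState Y a T T ω) i).real (Set.Ioi x) ∧
      (M.post (runState Y a T T ω) i).real (Set.Ioi x) < 1 - ε

/-- Almost surely, the probability of policy improvement is positive at all late steps. -/
def ImprovementPossible {N : ℕ} (M : Problem N) (D : Design N) {Ω : Type*} [MeasurableSpace Ω]
    (P : Measure Ω) (Y : Fin N → ℕ → Ω → ℝ) (a : ℕ → ℕ → Ω → Fin N) : Prop :=
  ∀ᵐ ω ∂P, ∀ᶠ t in atTop, ∀ T, t < T → 0 < D.probImprove M T t (runState Y a T t ω)

end RankingSelection

end

/-!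
The proof has two halves: every alternative is sampled more and more often as the budget grows, and
then the posterior laws concentrate at the true means, so that the best alternative is selected.

**Exploration.** The action values are at least some `c > 0`, because every final selection is
correct with probability at least `c`: the alternative most likely to be best is best with
probability at least `1 / N`, and for normal posteriors, whose means are medians, the one with the
largest mean is best with probability at least `2⁻ᴺ`. Hence with a probability that is bounded below
all rewards are `1`; if all tied alternatives may be chosen, then each alternative is sampled at each
step with a probability that is bounded below.

If instead the lookahead is bounded, it is used that the action values are also bounded away from `1`
as long as some alternative `i` has at most `n` observations and all sample means are in `[-R, R]`
(`Design.exists_actionValue_le`). The condition on the tails says that every prior charges all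
half-lines. So the mean of `i` may a posteriori lie above `3 R` or below `-3 R`, whereas each of the
other means lies within `3 R` with probability at least one half, for any number of observations
(`Problem.exists_half_le_post`); thus no selection is almost certainly correct. With a probability
that is bounded below, a simulated observation lies in `[-R, R]`, which keeps the sample means there,
so that the bound propagates through boundedly many rollout steps. Then the rewards of `i` may be `1`
and all others `0`, in which case `i` is sampled whatever the tie-breaking rule
(`Design.exists_le_stepProb`).

**Counting.** On the event that the averages of the true observations stay in `[-R, R]`, which is
known from the start of a run, the expectation of `2⁻ᶜ` restricted to `c ≤ n`, where `c` counts the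
observations of `i`, therefore decays geometrically along each run (`integral_weight_le`). The
probability that `i` has at most `n` observations at the end of the run is thus summable over the
budgets, and the Borel-Cantelli lemma applies whatever the joint law of the runs is. By the strong law
of large numbers almost every path has bounded averages.

**Consistency.** A true mean almost surely lies in the support of its prior, and the sample means tend
to the true means; the posterior laws then concentrate there (`Problem.tendsto_post_Ioo`), and under
normal priors the posterior means converge as well.
-/

noncomputable section

namespace RankingSelection

/-! ### Tilted measures -/

/-- A bound on the odds of `A` against `B` after tilting: the tilting changes the odds by at most
the ratio of the largest density on `A` to the smallest density on `B`. -/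
theorem tilted_real_mul_le {ν : Measure ℝ} [IsProbabilityMeasure ν] {f : ℝ → ℝ}
    (hf : Integrable (fun x => Real.exp (f x)) ν) {A B : Set ℝ} (hA : MeasurableSet A)
    (hB : MeasurableSet B) {α β : ℝ} (hfA : ∀ x ∈ A, f x ≤ α) (hfB : ∀ x ∈ B, β ≤ f x) :
    (ν.tilted f).real A * ν.real B ≤ Real.exp (α - β) * (ν.real A * (ν.tilted f).real B) := by
  have hZ : 0 < ∫ x, Real.exp (f x) ∂ν := integral_exp_pos hf
  set Z := ∫ x, Real.exp (f x) ∂ν with hZdef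
  have key : ∀ S : Set ℝ, MeasurableSet S →
      (ν.tilted f).real S = ∫ x in S, Real.exp (f x) / Z ∂ν := by
    intro S hS
    rw [measureReal_def, tilted_apply_eq_ofReal_integral' f hS, ENNReal.toReal_ofReal]
    exact integral_nonneg fun x => by positivity
  have h1 : (ν.tilted f).real A ≤ Real.exp α / Z * ν.real A := by
    rw [key A hA]
    calc ∫ x in A, Real.exp (f x) / Z ∂ν ≤ ∫ _ in A, Real.exp α / Z ∂ν := by
          refine setIntegral_mono_on (hf.div_const Z).integrableOn
            (integrable_const _).integrableOn hA fun x hx => ?_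
          have := hfA x hx
          gcongr
      _ = _ := by simp [mul_comm]
  have h2 : Real.exp β / Z * ν.real B ≤ (ν.tilted f).real B := by
    rw [key B hB]
    calc Real.exp β / Z * ν.real B = ∫ _ in B, Real.exp β / Z ∂ν := by simp [mul_comm]
      _ ≤ _ := by
          refine setIntegral_mono_on (integrable_const _).integrableOn
            (hf.div_const Z).integrableOn hB fun x hx => ?_
          have := hfB x hx
          gcongr
  have hA0 : 0 ≤ ν.real A := measureReal_nonneg
  have hB0 : 0 ≤ ν.real B := measureReal_nonneg
  calc (ν.tilted f).real A * ν.real B ≤ (Real.exp α / Z * ν.real A) * ν.real B := by gcongr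
    _ = Real.exp (α - β) * (ν.real A * (Real.exp β / Z * ν.real B)) := by
        rw [Real.exp_sub]; field_simp
    _ ≤ _ := by gcongr

/-! ### The posterior laws -/

namespace Problem

variable {N : ℕ} (M : Problem N)

instance (i : Fin N) : IsProbabilityMeasure (M.prior i) := M.isProb i

/-- The logarithm of the likelihood by which the prior of alternative `i` is tilted. -/
def logLik (s : State N) (i : Fin N) (θ : ℝ) : ℝ :=
  -((s i).1 * ((s i).2.1 - θ) ^ 2) / (2 * M.obsVar i)

theorem post_eq (s : State N) (i : Fin N) : M.post s i = (M.prior i).tilted (M.logLik s i) := rfl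

theorem obsVar_pos (i : Fin N) : 0 < (M.obsVar i : ℝ) :=
  NNReal.coe_pos.2 (pos_iff_ne_zero.2 (M.obsVar_ne_zero i))

theorem logLik_nonpos (s : State N) (i : Fin N) (θ : ℝ) : M.logLik s i θ ≤ 0 := by
  have := M.obsVar_pos i
  unfold logLik
  exact div_nonpos_of_nonpos_of_nonneg (neg_nonpos.2 (by positivity)) (by positivity)

theorem measurable_logLik_uncurry (i : Fin N) :
    Measurable fun p : State N × ℝ => M.logLik p.1 i p.2 := by
  unfold logLik
  have h : Measurable fun p : State N × ℝ => p.1 i := by fun_prop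
  have h1 : Measurable fun p : State N × ℝ => ((p.1 i).1 : ℝ) :=
    (measurable_of_countable (fun n : ℕ => (n : ℝ))).comp h.fst
  have h2 : Measurable fun p : State N × ℝ => (p.1 i).2.1 := h.snd.fst
  fun_prop

theorem measurable_logLik (s : State N) (i : Fin N) : Measurable (M.logLik s i) :=
  (M.measurable_logLik_uncurry i).comp measurable_prodMk_left

theorem integrable_exp_logLik (s : State N) (i : Fin N) :
    Integrable (fun θ => Real.exp (M.logLik s i θ)) (M.prior i) := by
  refine Integrable.of_bound (C := 1) (M.measurable_logLik s i).exp.aestronglyMeasurable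
    (ae_of_all _ fun θ => ?_)
  rw [Real.norm_eq_abs, Real.abs_exp]
  exact Real.exp_le_one_iff.2 (M.logLik_nonpos s i θ)

instance (s : State N) (i : Fin N) : IsProbabilityMeasure (M.post s i) :=
  isProbabilityMeasure_tilted (M.integrable_exp_logLik s i)

instance (s : State N) : IsProbabilityMeasure (M.posterior s) := by
  unfold posterior; infer_instance

theorem measurable_post (i : Fin N) : Measurable fun s : State N => M.post s i := by
  refine Measure.measurable_of_measurable_coe _ fun A hA => ?_
  simp only [post_eq, tilted_apply]
  have h1 : Measurable fun p : State N × ℝ => Real.exp (M.logLik p.1 i p.2) :=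
    (M.measurable_logLik_uncurry i).exp
  have h2 : Measurable fun s : State N => ∫ x, Real.exp (M.logLik s i x) ∂(M.prior i) :=
    h1.stronglyMeasurable.integral_prod_right'.measurable
  have h3 : Measurable fun p : State N × ℝ => ENNReal.ofReal (Real.exp (M.logLik p.1 i p.2)
      / ∫ x, Real.exp (M.logLik p.1 i x) ∂(M.prior i)) :=
    (h1.div (h2.comp measurable_fst)).ennreal_ofReal
  exact h3.lintegral_prod_right' (ν := (M.prior i).restrict A)

/-- The posterior law of the mean of alternative `i`, as a Markov kernel. -/
def postKernel (i : Fin N) : Kernel (State N) ℝ := ⟨fun s => M.post s i, M.measurable_post i⟩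

instance (i : Fin N) : IsMarkovKernel (M.postKernel i) :=
  ⟨fun s => inferInstanceAs (IsProbabilityMeasure (M.post s i))⟩

theorem measurable_posterior : Measurable M.posterior := by
  refine Measurable.measure_of_isPiSystem_of_isProbabilityMeasure generateFrom_pi.symm
    isPiSystem_pi ?_
  rintro _ ⟨S, hS, rfl⟩
  simp only [posterior, Measure.pi_pi]
  exact Finset.measurable_prod _ fun i _ =>
    (Measure.measurable_coe (by simpa using hS i (Set.mem_univ i))).comp (M.measurable_post i)

theorem measurableSet_isBest (i : Fin N) : MeasurableSet {θ : Fin N → ℝ | ∀ j, θ j ≤ θ i} := by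
  simp only [Set.ofPred_forall]
  exact MeasurableSet.iInter fun j =>
    measurableSet_le (measurable_pi_apply j) (measurable_pi_apply i)

theorem measurable_probBest (i : Fin N) : Measurable fun s => M.probBest s i :=
  ((Measure.measurable_coe (measurableSet_isBest i)).comp M.measurable_posterior).ennreal_toReal

theorem posterior_real_pi (s : State N) (S : Fin N → Set ℝ) :
    (M.posterior s).real (Set.univ.pi S) = ∏ i, (M.post s i).real (S i) := by
  simp [posterior, measureReal_def, Measure.pi_pi, ENNReal.toReal_prod]

theorem probBest_nonneg (s : State N) (i : Fin N) : 0 ≤ M.probBest s i := measureReal_nonneg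

theorem probBest_le_one (s : State N) (i : Fin N) : M.probBest s i ≤ 1 := measureReal_le_one

/-- A rectangle on which `k` is not a best alternative bounds `probBest s k` away from `1`. -/
theorem probBest_le_one_sub (s : State N) (k : Fin N) (S : Fin N → Set ℝ)
    (hS : ∀ i, MeasurableSet (S i)) {q : ℝ} (hq : 0 ≤ q) (hqS : ∀ i, q ≤ (M.post s i).real (S i))
    (hk : ∀ θ : Fin N → ℝ, (∀ i, θ i ∈ S i) → ∃ j, θ k < θ j) :
    M.probBest s k ≤ 1 - q ^ N := by
  have h1 : q ^ N ≤ (M.posterior s).real (Set.univ.pi S) := by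
    rw [posterior_real_pi]
    calc q ^ N = ∏ _i : Fin N, q := by simp
      _ ≤ _ := Finset.prod_le_prod (fun _ _ => hq) fun i _ => hqS i
  have h2 : {θ : Fin N → ℝ | ∀ j, θ j ≤ θ k} ⊆ (Set.univ.pi S)ᶜ := by
    intro θ hθ hθS
    obtain ⟨j, hj⟩ := hk θ fun i => hθS i (Set.mem_univ i)
    exact absurd (hθ j) (not_le.2 hj)
  have h3 := measureReal_mono (μ := M.posterior s) h2
  rw [probReal_compl_eq_one_sub (MeasurableSet.univ_pi hS)] at h3
  unfold probBest
  linarith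

/-- A rectangle on which `k` is a best alternative bounds `probBest s k` away from `0`. -/
theorem pow_le_probBest (s : State N) (k : Fin N) (S : Fin N → Set ℝ)
    {q : ℝ} (hq : 0 ≤ q) (hqS : ∀ i, q ≤ (M.post s i).real (S i))
    (hk : ∀ θ : Fin N → ℝ, (∀ i, θ i ∈ S i) → ∀ j, θ j ≤ θ k) :
    q ^ N ≤ M.probBest s k := by
  calc q ^ N = ∏ _i : Fin N, q := by simp
    _ ≤ ∏ i, (M.post s i).real (S i) := Finset.prod_le_prod (fun _ _ => hq) fun i _ => hqS i
    _ = (M.posterior s).real (Set.univ.pi S) := (M.posterior_real_pi s S).symm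
    _ ≤ _ := measureReal_mono fun θ hθ => hk θ fun i => hθ i (Set.mem_univ i)

/-- Every prior charges all half-lines. -/
def FullTails : Prop :=
  ∀ i x, 0 < (M.prior i).real (Set.Ioi x) ∧ 0 < (M.prior i).real (Set.Iio x)

/-- For large `R`, if the sample mean of `i` is in `[-R, R]`, then at least half of the posterior mass
is in `(-3R, 3R)`, no matter how many observations there are: these favour `[-R, R]` over
`|θ| ≥ 3R`, and the prior does so for large `R`. -/
theorem exists_half_le_post : ∃ R₀ : ℝ, 0 < R₀ ∧ ∀ R, R₀ ≤ R → ∀ (s : State N) (i : Fin N),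
    |(s i).2.1| ≤ R → 1 / 2 ≤ (M.post s i).real (Set.Ioo (-(3 * R)) (3 * R)) := by
  have h1 : ∀ i, ∃ R₀ : ℝ, 0 < R₀ ∧ ∀ R, R₀ ≤ R → 1 / 2 < (M.prior i).real (Set.Icc (-R) R) := by
    intro i
    have h := tendsto_measure_iUnion_atTop (μ := M.prior i)
      (s := fun R : ℝ => Set.Icc (-R) R) fun a b hab => Set.Icc_subset_Icc (neg_le_neg hab) hab
    have hU : (⋃ R : ℝ, Set.Icc (-R) R) = Set.univ :=
      Set.eq_univ_of_forall fun x => Set.mem_iUnion.2 ⟨|x|, abs_le.1 le_rfl⟩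
    rw [hU, measure_univ] at h
    have h' := (ENNReal.tendsto_toReal (by simp)).comp h
    have h'' := h'.eventually (lt_mem_nhds (a := (1 / 2 : ℝ)) (by simp; norm_num))
    obtain ⟨a, ha⟩ := (h''.and (eventually_gt_atTop 0)).exists_forall_of_atTop
    exact ⟨a, (ha a le_rfl).2, fun R hR => (ha R hR).1⟩
  choose R₀ hR₀ h using h1
  have hsum := Finset.sum_nonneg fun i (_ : i ∈ Finset.univ) => (hR₀ i).le
  refine ⟨1 + ∑ i, R₀ i, by linarith, fun R hR s i hm => ?_⟩
  have hRi : R₀ i ≤ R := by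
    have := Finset.single_le_sum (fun i (_ : i ∈ Finset.univ) => (hR₀ i).le) (Finset.mem_univ i)
    linarith
  have hR0 : 0 < R := (hR₀ i).trans_le hRi
  have hB := h i R hRi
  have hm' := abs_le.1 hm
  have hv := M.obsVar_pos i
  have key := tilted_real_mul_le (M.integrable_exp_logLik s i)
    (A := (Set.Ioo (-(3 * R)) (3 * R))ᶜ) (B := Set.Icc (-R) R)
    measurableSet_Ioo.compl measurableSet_Icc
    (α := -((s i).1 * (2 * R) ^ 2) / (2 * M.obsVar i))
    (β := -((s i).1 * (2 * R) ^ 2) / (2 * M.obsVar i))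
    (by
      intro θ hθ
      unfold logLik
      have : (2 * R) ^ 2 ≤ ((s i).2.1 - θ) ^ 2 := by
        rw [sq_le_sq, abs_of_pos (by linarith : 0 < 2 * R)]
        by_cases h : -(3 * R) < θ
        · have : 3 * R ≤ θ := by by_contra h'; exact hθ ⟨h, not_le.1 h'⟩
          rw [abs_of_nonpos (by linarith)]; linarith
        · rw [abs_of_nonneg (by linarith)]; linarith
      gcongr)
    (by
      intro θ hθ
      unfold logLik
      have : ((s i).2.1 - θ) ^ 2 ≤ (2 * R) ^ 2 := by
        rw [sq_le_sq, abs_of_pos (by linarith : 0 < 2 * R), abs_le]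
        constructor <;> linarith [hθ.1, hθ.2]
      gcongr)
  rw [sub_self, Real.exp_zero, one_mul, ← post_eq] at key
  have hsub : (M.prior i).real (Set.Ioo (-(3 * R)) (3 * R))ᶜ ≤ (M.prior i).real (Set.Icc (-R) R) := by
    have h3 : (M.prior i).real (Set.Icc (-R) R) ≤ (M.prior i).real (Set.Ioo (-(3 * R)) (3 * R)) :=
      measureReal_mono fun x hx => ⟨by linarith [hx.1], by linarith [hx.2]⟩
    rw [probReal_compl_eq_one_sub measurableSet_Ioo]
    linarith
  have hBA : (M.post s i).real (Set.Icc (-R) R) ≤ (M.post s i).real (Set.Ioo (-(3 * R)) (3 * R)) :=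
    measureReal_mono fun x hx => ⟨by linarith [hx.1], by linarith [hx.2]⟩
  rw [probReal_compl_eq_one_sub (μ := M.post s i) measurableSet_Ioo] at key
  have hB0 : 0 < (M.prior i).real (Set.Icc (-R) R) := by linarith
  have h4 : (1 - (M.post s i).real (Set.Ioo (-(3 * R)) (3 * R))) * (M.prior i).real (Set.Icc (-R) R)
      ≤ (M.post s i).real (Set.Ioo (-(3 * R)) (3 * R)) * (M.prior i).real (Set.Icc (-R) R) := by
    refine key.trans ?_
    rw [mul_comm]
    exact mul_le_mul hBA hsub measureReal_nonneg measureReal_nonneg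
  have := le_of_mul_le_mul_right h4 hB0
  linarith

/-- On a bounded set `B` charged by the prior, the posterior mass is bounded below as long as there
are few observations with a bounded sample mean. -/
theorem exists_pos_le_post {i : Fin N} {B : Set ℝ} (hB : MeasurableSet B) {L : ℝ}
    (hL : ∀ θ ∈ B, |θ| ≤ L) (hpos : 0 < (M.prior i).real B) (R : ℝ) (n : ℕ) :
    ∃ δ : ℝ, 0 < δ ∧ ∀ s : State N, |(s i).2.1| ≤ R → (s i).1 ≤ n → δ ≤ (M.post s i).real B := by
  set β : ℝ := -(n * (R + L) ^ 2) / (2 * M.obsVar i) with hβ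
  have hv := M.obsVar_pos i
  refine ⟨Real.exp β * (M.prior i).real B, by positivity, fun s hm hn => ?_⟩
  have key := tilted_real_mul_le (M.integrable_exp_logLik s i) MeasurableSet.univ hB
    (α := 0) (β := β) (fun θ _ => M.logLik_nonpos s i θ)
    (by
      intro θ hθ
      have hn' : ((s i).1 : ℝ) ≤ n := by exact_mod_cast hn
      have : ((s i).2.1 - θ) ^ 2 ≤ (R + L) ^ 2 := by
        have hRL : |(s i).2.1 - θ| ≤ R + L := (abs_sub _ _).trans (add_le_add hm (hL θ hθ))
        exact sq_le_sq' (by linarith [neg_abs_le ((s i).2.1 - θ)]) ((le_abs_self _).trans hRL)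
      simp only [hβ, logLik]
      gcongr)
  rw [← post_eq, probReal_univ, probReal_univ, one_mul, one_mul, zero_sub, Real.exp_neg] at key
  have he := Real.exp_pos β
  calc Real.exp β * (M.prior i).real B ≤ Real.exp β * ((Real.exp β)⁻¹ * (M.post s i).real B) := by
        gcongr
    _ = _ := by field_simp

variable {M} in
theorem FullTails.exists_Ioc (h : M.FullTails) (i : Fin N) (x : ℝ) :
    ∃ y, 0 < (M.prior i).real (Set.Ioc x y) := by
  have hU : (⋃ n : ℕ, Set.Ioc x (x + n)) = Set.Ioi x := by
    ext y
    simp only [Set.mem_iUnion, Set.mem_Ioc, Set.mem_Ioi]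
    refine ⟨fun ⟨n, hn⟩ => hn.1, fun hy => ?_⟩
    obtain ⟨n, hn⟩ := exists_nat_ge (y - x)
    exact ⟨n, hy, by linarith⟩
  have h0 : M.prior i (⋃ n : ℕ, Set.Ioc x (x + n)) ≠ 0 := by
    rw [hU]; intro h0; have := (h i x).1; simp [measureReal_def, h0] at this
  obtain ⟨n, hn⟩ := exists_measure_pos_of_not_measure_iUnion_null h0
  exact ⟨x + n, ENNReal.toReal_pos hn.ne' (measure_ne_top _ _)⟩

variable {M} in
theorem FullTails.exists_Ico (h : M.FullTails) (i : Fin N) (x : ℝ) :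
    ∃ y, 0 < (M.prior i).real (Set.Ico y x) := by
  have hU : (⋃ n : ℕ, Set.Ico (x - n) x) = Set.Iio x := by
    ext y
    simp only [Set.mem_iUnion, Set.mem_Ico, Set.mem_Iio]
    refine ⟨fun ⟨n, hn⟩ => hn.2, fun hy => ?_⟩
    obtain ⟨n, hn⟩ := exists_nat_ge (x - y)
    exact ⟨n, by linarith, hy⟩
  have h0 : M.prior i (⋃ n : ℕ, Set.Ico (x - n) x) ≠ 0 := by
    rw [hU]; intro h0; have := (h i x).2; simp [measureReal_def, h0] at this
  obtain ⟨n, hn⟩ := exists_measure_pos_of_not_measure_iUnion_null h0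
  exact ⟨x - n, ENNReal.toReal_pos hn.ne' (measure_ne_top _ _)⟩

end Problem

/-! ### The probabilities of being best -/

/-- Finitely many positive numbers have a positive lower bound. -/
theorem exists_pos_le_of_finite {ι : Type*} [Finite ι] (f : ι → ℝ) (hf : ∀ i, 0 < f i) :
    ∃ δ : ℝ, 0 < δ ∧ ∀ i, δ ≤ f i := by
  cases isEmpty_or_nonempty ι
  · exact ⟨1, one_pos, fun i => isEmptyElim i⟩
  · obtain ⟨i, hi⟩ := Finite.exists_min f
    exact ⟨f i, hf i, hi⟩

/-- All sample means are in `[-R, R]`. -/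
def State.MeansBounded {N : ℕ} (R : ℝ) (s : State N) : Prop := ∀ k, |(s k).2.1| ≤ R

namespace Problem

variable {N : ℕ} (M : Problem N)

/-- As long as some alternative has few observations, no alternative is almost certainly a best
one, however many observations of the others there are. -/
theorem exists_probBest_le (hN : 1 < N) (hT : M.FullTails) :
    ∃ R₀ : ℝ, 0 < R₀ ∧ ∀ R, R₀ ≤ R → ∀ n : ℕ, ∃ δ : ℝ, 0 < δ ∧ ∀ s : State N, s.MeansBounded R →
      (∃ i, (s i).1 ≤ n) → ∀ k, M.probBest s k ≤ 1 - δ := by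
  obtain ⟨R₀, hR₀, hhalf⟩ := M.exists_half_le_post
  refine ⟨R₀, hR₀, fun R hR n => ?_⟩
  have hup : ∀ i, ∃ δ : ℝ, 0 < δ ∧ ∀ s : State N, |(s i).2.1| ≤ R → (s i).1 ≤ n →
      δ ≤ (M.post s i).real (Set.Ioi (3 * R)) := by
    intro i
    obtain ⟨y, hy⟩ := hT.exists_Ioc i (3 * R)
    obtain ⟨δ, hδ, h⟩ := M.exists_pos_le_post measurableSet_Ioc (L := |3 * R| + |y|)
      (fun θ hθ => abs_le.2 ⟨by linarith [neg_abs_le (3 * R), abs_nonneg y, hθ.1],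
        by linarith [le_abs_self y, abs_nonneg (3 * R), hθ.2]⟩) hy R n
    exact ⟨δ, hδ, fun s h1 h2 => (h s h1 h2).trans (measureReal_mono fun x hx => hx.1)⟩
  have hdown : ∀ i, ∃ δ : ℝ, 0 < δ ∧ ∀ s : State N, |(s i).2.1| ≤ R → (s i).1 ≤ n →
      δ ≤ (M.post s i).real (Set.Iio (-(3 * R))) := by
    intro i
    obtain ⟨y, hy⟩ := hT.exists_Ico i (-(3 * R))
    obtain ⟨δ, hδ, h⟩ := M.exists_pos_le_post measurableSet_Ico (L := |-(3 * R)| + |y|)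
      (fun θ hθ => abs_le.2 ⟨by linarith [neg_abs_le y, abs_nonneg (-(3 * R)), hθ.1],
        by linarith [le_abs_self (-(3 * R)), abs_nonneg y, hθ.2]⟩) hy R n
    exact ⟨δ, hδ, fun s h1 h2 => (h s h1 h2).trans (measureReal_mono fun x hx => hx.2)⟩
  choose δ₁ hδ₁ hup using hup
  choose δ₂ hδ₂ hdown using hdown
  obtain ⟨d₁, hd₁, h₁⟩ := exists_pos_le_of_finite δ₁ hδ₁
  obtain ⟨d₂, hd₂, h₂⟩ := exists_pos_le_of_finite δ₂ hδ₂
  set q : ℝ := min (min d₁ d₂) (1 / 2) with hq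
  have hq0 : 0 < q := by positivity
  have hq1 : q ≤ d₁ := (min_le_left _ _).trans (min_le_left _ _)
  have hq2 : q ≤ d₂ := (min_le_left _ _).trans (min_le_right _ _)
  refine ⟨q ^ N, by positivity, fun s hs ⟨i, hi⟩ k => ?_⟩
  have hq3 : ∀ j, q ≤ (M.post s j).real (Set.Ioo (-(3 * R)) (3 * R)) := fun j =>
    (min_le_right _ _).trans (hhalf R hR s j (hs j))
  by_cases hki : k = i
  · -- The poorly known `i` may lie below `-3R`, and the other alternatives within `3R`.
    subst hki
    have : Nontrivial (Fin N) := Fin.nontrivial_iff_two_le.2 hN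
    obtain ⟨j, hj⟩ := exists_ne k
    refine M.probBest_le_one_sub s k
      (fun l => if l = k then Set.Iio (-(3 * R)) else Set.Ioo (-(3 * R)) (3 * R))
      (fun l => by split_ifs <;> measurability) hq0.le (fun l => ?_) fun θ hθ => ⟨j, ?_⟩
    · by_cases h : l = k
      · subst h; simpa using (hq2.trans (h₂ _)).trans (hdown _ s (hs _) hi)
      · simpa [h] using hq3 l
    · have h1 := hθ k
      have h2 := hθ j
      simp only [if_true, hj, if_false, Set.mem_Iio, Set.mem_Ioo] at h1 h2
      linarith
  · -- The poorly known `i` may lie above `3R`, and the other alternatives within `3R`.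
    refine M.probBest_le_one_sub s k
      (fun l => if l = i then Set.Ioi (3 * R) else Set.Ioo (-(3 * R)) (3 * R))
      (fun l => by split_ifs <;> measurability) hq0.le (fun l => ?_) fun θ hθ => ⟨i, ?_⟩
    · by_cases h : l = i
      · subst h; simpa using (hq1.trans (h₁ _)).trans (hup _ s (hs _) hi)
      · simpa [h] using hq3 l
    · have h1 := hθ i
      have h2 := hθ k
      simp only [if_true, hki, if_false, Set.mem_Ioi, Set.mem_Ioo] at h1 h2
      linarith

/-- If every alternative is a posteriori within `ε` of `c` with high probability, and `i` is the
best alternative of `c` by a margin of `2 ε`, then `i` is selected by `probBest`. -/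
theorem SelectsMaxProb.eq_of_concentrated {M : Problem N} {sel : State N → Fin N}
    (h : M.SelectsMaxProb sel) (s : State N) (c : Fin N → ℝ) {i : Fin N} {ε q : ℝ}
    (hgap : ∀ j, j ≠ i → c j + 2 * ε ≤ c i)
    (hq : 0 ≤ q) (hq2 : 1 / 2 < q ^ N)
    (hc : ∀ j, q ≤ (M.post s j).real (Set.Ioo (c j - ε) (c j + ε))) : sel s = i := by
  by_contra hne
  have h1 : q ^ N ≤ M.probBest s i := by
    refine M.pow_le_probBest s i _ hq hc fun θ hθ j => ?_
    by_cases hji : j = i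
    · rw [hji]
    · linarith [(hθ j).2, (hθ i).1, hgap j hji]
  have h2 : M.probBest s (sel s) ≤ 1 - q ^ N := by
    refine M.probBest_le_one_sub s (sel s) _ (fun _ => measurableSet_Ioo) hq hc
      fun θ hθ => ⟨i, ?_⟩
    linarith [(hθ (sel s)).2, (hθ i).1, hgap _ hne]
  linarith [h s i]

/-- Since some alternative is best, the largest probability of being best is at least `1 / N`. -/
theorem SelectsMaxProb.exists_le {M : Problem N} {sel : State N → Fin N}
    (h : M.SelectsMaxProb sel) : ∃ c : ℝ, 0 < c ∧ ∀ s, c ≤ M.probBest s (sel s) := by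
  rcases Nat.eq_zero_or_pos N with rfl | hN
  · exact ⟨1, one_pos, fun s => (sel s).elim0⟩
  have : Nonempty (Fin N) := ⟨⟨0, hN⟩⟩
  refine ⟨1 / N, by positivity, fun s => ?_⟩
  have h1 : 1 ≤ ∑ i, M.probBest s i := by
    have hU :
        (⋃ i ∈ (Finset.univ : Finset (Fin N)), {θ : Fin N → ℝ | ∀ j, θ j ≤ θ i}) = Set.univ := by
      refine Set.eq_univ_of_forall fun θ => ?_
      obtain ⟨i, hi⟩ := Finite.exists_max θ
      exact Set.mem_biUnion (Finset.mem_univ i) hi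
    calc (1 : ℝ) = (M.posterior s).real Set.univ := probReal_univ.symm
      _ ≤ _ := by rw [← hU]; exact measureReal_biUnion_finset_le _ _
  have h2 : ∑ i, M.probBest s i ≤ N * M.probBest s (sel s) := by
    calc ∑ i, M.probBest s i ≤ ∑ _i : Fin N, M.probBest s (sel s) :=
          Finset.sum_le_sum fun j _ => h s j
      _ = _ := by simp
  rw [div_le_iff₀ (by positivity)]
  linarith

end Problem

/-! ### The predictive law of the next observation -/

/-- A function that is at most `1`, and at most `1 - δ` on a set of probability at least `p`, has
mean at most `1 - δ p`. -/
theorem integral_le_one_sub {X : Type*} [MeasurableSpace X] {κ : Measure X}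
    [IsProbabilityMeasure κ] {f : X → ℝ} (hf : Integrable f κ) {A : Set X} (hA : MeasurableSet A)
    {δ p : ℝ} (hδ : 0 ≤ δ) (h1 : ∀ x, f x ≤ 1) (hAf : ∀ x ∈ A, f x ≤ 1 - δ) (hp : p ≤ κ.real A) :
    ∫ x, f x ∂κ ≤ 1 - δ * p := by
  have hint : Integrable (fun x => 1 - A.indicator (fun _ => δ) x) κ :=
    (integrable_const 1).sub ((integrable_const δ).indicator hA)
  calc ∫ x, f x ∂κ ≤ ∫ x, (1 - A.indicator (fun _ => δ) x) ∂κ := by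
        refine integral_mono hf hint fun x => ?_
        by_cases hx : x ∈ A
        · simpa [hx] using hAf x hx
        · simpa [hx] using h1 x
    _ = 1 - δ * κ.real A := by
        rw [integral_sub (integrable_const 1) ((integrable_const δ).indicator hA),
          integral_indicator hA]
        simp [mul_comm]
    _ ≤ 1 - δ * p := by gcongr

namespace Problem

variable {N : ℕ} (M : Problem N)

/-- The law of an observation of alternative `i` as a function of its mean. -/
def obsKernel (i : Fin N) : Kernel ℝ ℝ :=
  ⟨fun θ => gaussianReal θ (M.obsVar i), by
    have h : Measurable fun θ : ℝ => (θ, M.obsVar i) := by fun_prop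
    exact measurable_gaussianReal.comp h⟩

instance (i : Fin N) : IsMarkovKernel (M.obsKernel i) :=
  ⟨fun θ => inferInstanceAs (IsProbabilityMeasure (gaussianReal θ (M.obsVar i)))⟩

/-- The predictive law of the next observation of alternative `i`. -/
def predKernel (i : Fin N) : Kernel (State N) ℝ := M.obsKernel i ∘ₖ M.postKernel i

instance (i : Fin N) : IsMarkovKernel (M.predKernel i) := by
  unfold predKernel; infer_instance

/-- An observation whose mean is not far from `[-R, R]` may fall into `[-R, R]`. -/
theorem exists_pos_le_gaussianReal {v : ℝ≥0} (hv : v ≠ 0) {R : ℝ} (hR : 0 < R) :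
    ∃ g : ℝ≥0∞, 0 < g ∧ ∀ θ ∈ Set.Ioo (-(3 * R)) (3 * R),
      g ≤ gaussianReal θ v (Set.Icc (-R) R) := by
  set b : ℝ := (√(2 * Real.pi * v))⁻¹ * Real.exp (-(4 * R) ^ 2 / (2 * v)) with hb
  have hv' : 0 < (v : ℝ) := NNReal.coe_pos.2 (pos_iff_ne_zero.2 hv)
  have hb0 : 0 < b := by positivity
  refine ⟨ENNReal.ofReal b * ENNReal.ofReal (R - -R), ?_, fun θ hθ => ?_⟩
  · exact ENNReal.mul_pos (by simpa using hb0) (by simp; linarith)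
  · rw [gaussianReal_apply θ hv, ← Real.volume_Icc, ← setLIntegral_const]
    refine setLIntegral_mono (measurable_gaussianPDF _ _) fun x hx => ?_
    refine ENNReal.ofReal_le_ofReal ?_
    have : (x - θ) ^ 2 ≤ (4 * R) ^ 2 :=
      sq_le_sq' (by linarith [hx.1, hθ.2]) (by linarith [hx.2, hθ.1])
    rw [hb, gaussianPDFReal]
    gcongr

/-- With a probability that is bounded below, the next observation leaves the sample means in
`[-R, R]`. -/
theorem exists_pos_le_predKernel :
    ∃ R₀ : ℝ, 0 < R₀ ∧ ∀ R, R₀ ≤ R → ∃ p : ℝ, 0 < p ∧ ∀ s : State N, s.MeansBounded R →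
      ∀ i, p ≤ (M.predKernel i s).real (Set.Icc (-R) R) := by
  obtain ⟨R₀, hR₀, hhalf⟩ := M.exists_half_le_post
  refine ⟨R₀, hR₀, fun R hR => ?_⟩
  choose g hg0 hg using fun i => exists_pos_le_gaussianReal (M.obsVar_ne_zero i) (hR₀.trans_le hR)
  have hg1 : ∀ i, g i ≤ 1 := fun i => (hg i 0 (by constructor <;> linarith)).trans prob_le_one
  have hgr : ∀ i, 0 < (g i).toReal := fun i =>
    ENNReal.toReal_pos (hg0 i).ne' (ne_top_of_le_ne_top ENNReal.one_ne_top (hg1 i))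
  obtain ⟨d, hd, hdg⟩ := exists_pos_le_of_finite (fun i => (g i).toReal) hgr
  refine ⟨d * (1 / 2), by positivity, fun s hs i => ?_⟩
  have h1 : g i * M.post s i (Set.Ioo (-(3 * R)) (3 * R))
      ≤ M.predKernel i s (Set.Icc (-R) R) := by
    rw [predKernel, Kernel.comp_apply' _ _ _ measurableSet_Icc, ← setLIntegral_const]
    refine le_trans ?_ (setLIntegral_le_lintegral (Set.Ioo (-(3 * R)) (3 * R)) _)
    exact setLIntegral_mono' measurableSet_Ioo fun θ hθ => hg i θ hθ
  have h2 := ENNReal.toReal_mono (measure_ne_top _ _) h1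
  rw [ENNReal.toReal_mul] at h2
  refine le_trans ?_ h2
  exact mul_le_mul (hdg i) (hhalf R hR s i (hs i)) (by norm_num) ENNReal.toReal_nonneg

end Problem

/-! ### The statistics -/

namespace State

variable {N : ℕ}

theorem measurable_update (i : Fin N) :
    Measurable fun p : State N × ℝ => p.1.update i p.2 := by
  have h : ∀ k, Measurable fun p : State N × ℝ => p.1 k := fun k => by fun_prop
  have h1 : Measurable fun p : State N × ℝ => ((p.1 i).1 : ℝ) :=
    (measurable_of_countable (fun n : ℕ => (n : ℝ))).comp (h i).fst
  have h1' : Measurable fun p : State N × ℝ => (p.1 i).1 + 1 :=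
    (measurable_of_countable (fun n : ℕ => n + 1)).comp (h i).fst
  have h2 : Measurable fun p : State N × ℝ => (p.1 i).2.1 := (h i).snd.fst
  have h3 : Measurable fun p : State N × ℝ => (p.1 i).2.2 := (h i).snd.snd
  refine measurable_pi_iff.2 fun k => ?_
  by_cases hk : k = i
  · subst hk
    simp only [update, Function.update_self]
    exact h1'.prodMk (Measurable.prodMk (by fun_prop) (by fun_prop))
  · simpa [update, Function.update_of_ne hk] using h k

theorem update_count_self (s : State N) (i : Fin N) (x : ℝ) : (s.update i x i).1 = (s i).1 + 1 := by
  simp [update]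

theorem update_of_ne (s : State N) {i k : Fin N} (h : k ≠ i) (x : ℝ) : s.update i x k = s k := by
  simp [update, h]

theorem update_count_le (s : State N) (i k : Fin N) (x : ℝ) :
    (s.update i x k).1 ≤ (s k).1 + 1 := by
  by_cases h : k = i
  · subst h; rw [update_count_self]
  · rw [update_of_ne s h]; omega

theorem MeansBounded.update {R : ℝ} {s : State N} (hs : s.MeansBounded R) (i : Fin N) {x : ℝ}
    (hx : x ∈ Set.Icc (-R) R) : (s.update i x).MeansBounded R := by
  intro k
  by_cases h : k = i
  · subst h
    have hk := abs_le.1 (hs k)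
    have hn : (0 : ℝ) ≤ (s k).1 := by positivity
    simp only [State.update, Function.update_self]
    rw [abs_le, le_div_iff₀ (by positivity), div_le_iff₀ (by positivity)]
    constructor <;> nlinarith [hx.1, hx.2, hk.1, hk.2]
  · rw [update_of_ne s h]; exact hs k

end State

/-! ### The values of the rollouts -/

namespace Design

variable {N : ℕ} (D : Design N) (M : Problem N)

instance (m : ℕ) : IsMarkovKernel (D.base m) := D.isMarkov m

theorem sum_base (m : ℕ) (s : State N) : ∑ i, (D.base m s).real {i} = 1 := by
  rw [sum_measureReal_singleton, Finset.coe_univ, probReal_univ]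

theorem integrable_of_mem_Icc {X : Type*} [MeasurableSpace X] {κ : Measure X} [IsFiniteMeasure κ]
    {f : X → ℝ} (hf : Measurable f) (h : ∀ x, f x ∈ Set.Icc (0 : ℝ) 1) : Integrable f κ :=
  Integrable.of_bound (C := 1) hf.aestronglyMeasurable (ae_of_all _ fun x => by
    rw [Real.norm_eq_abs, abs_of_nonneg (h x).1]; exact (h x).2)

theorem measurable_probBest_sel : Measurable fun s => M.probBest s (D.sel s) := by
  have h : ∀ s, M.probBest s (D.sel s)
      = ∑ i, (D.sel ⁻¹' {i}).indicator (fun s => M.probBest s i) s := by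
    intro s
    rw [Finset.sum_eq_single (D.sel s)]
    · simp
    · intro i _ hi
      exact Set.indicator_of_notMem (fun h : D.sel s = i => hi h.symm) _
    · simp
  rw [funext h]
  exact Finset.measurable_sum _ fun i _ =>
    (M.measurable_probBest i).indicator (D.measurable_sel (measurableSet_singleton i))

/-- An iterated integral against the posterior and the law of an observation is an integral against
the predictive law. -/
theorem integral_predKernel {f : State N → ℝ} (hf : Measurable f)
    (h : ∀ s, f s ∈ Set.Icc (0 : ℝ) 1) (s : State N) (i : Fin N) :
    ∫ θ, ∫ x, f (s.update i x) ∂(gaussianReal θ (M.obsVar i)) ∂(M.post s i)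
      = ∫ x, f (s.update i x) ∂(M.predKernel i s) := by
  have hm : Measurable fun x => f (s.update i x) :=
    hf.comp ((State.measurable_update i).comp measurable_prodMk_left)
  exact (Kernel.integral_comp (η := M.obsKernel i) (κ := M.postKernel i) (a := s)
    (integrable_of_mem_Icc hm fun x => h _)).symm

theorem pcs_measurable_mem (m : ℕ) :
    Measurable (D.pcs M m) ∧ ∀ s, D.pcs M m s ∈ Set.Icc (0 : ℝ) 1 := by
  induction m with
  | zero =>
    exact ⟨D.measurable_probBest_sel M, fun s => ⟨M.probBest_nonneg _ _, M.probBest_le_one _ _⟩⟩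
  | succ m ih =>
    obtain ⟨hm, hI⟩ := ih
    have hup : ∀ i, Measurable fun p : State N × ℝ => D.pcs M m (p.1.update i p.2) := fun i =>
      hm.comp (State.measurable_update i)
    constructor
    · simp only [pcs, integral_predKernel M hm hI]
      refine Finset.measurable_sum _ fun i _ => Measurable.mul ?_ ?_
      · exact ((D.base (m + 1)).measurable_coe (measurableSet_singleton i)).ennreal_toReal
      · exact (StronglyMeasurable.integral_kernel_prod_right (κ := M.predKernel i)
          (f := fun s x => D.pcs M m (s.update i x)) (hup i).stronglyMeasurable).measurable
    · intro s
      simp only [pcs]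
      constructor
      · exact Finset.sum_nonneg fun i _ => mul_nonneg measureReal_nonneg
          (integral_nonneg fun θ => integral_nonneg fun x => (hI _).1)
      · rw [← D.sum_base (m + 1) s]
        refine Finset.sum_le_sum fun i _ => mul_le_of_le_one_right measureReal_nonneg ?_
        rw [integral_predKernel M hm hI]
        calc ∫ x, D.pcs M m (s.update i x) ∂(M.predKernel i s) ≤ ∫ _, 1 ∂(M.predKernel i s) :=
              integral_mono (integrable_of_mem_Icc ((hup i).comp measurable_prodMk_left) fun _ => hI _)
                (integrable_const _) fun x => (hI _).2
          _ = 1 := by simp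

theorem actionValue_eq (m : ℕ) (s : State N) (i : Fin N) :
    D.actionValue M m s i = ∫ x, D.pcs M m (s.update i x) ∂(M.predKernel i s) :=
  integral_predKernel M (D.pcs_measurable_mem M m).1 (D.pcs_measurable_mem M m).2 s i

theorem integrable_pcs_update (m : ℕ) (s : State N) (i : Fin N) :
    Integrable (fun x => D.pcs M m (s.update i x)) (M.predKernel i s) :=
  integrable_of_mem_Icc ((D.pcs_measurable_mem M m).1.comp
    ((State.measurable_update i).comp measurable_prodMk_left))
    fun _ => (D.pcs_measurable_mem M m).2 _

theorem pcs_succ (m : ℕ) (s : State N) :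
    D.pcs M (m + 1) s = ∑ i, (D.base (m + 1) s).real {i} * D.actionValue M m s i := rfl

theorem le_actionValue_of_le_pcs {c : ℝ} {m : ℕ} (h : ∀ s, c ≤ D.pcs M m s) (s : State N)
    (i : Fin N) : c ≤ D.actionValue M m s i := by
  rw [actionValue_eq]
  calc c = ∫ _, c ∂(M.predKernel i s) := by simp
    _ ≤ _ := integral_mono (integrable_const _) (D.integrable_pcs_update M m s i) fun x => h _

theorem le_pcs {c : ℝ} (hc : ∀ s, c ≤ M.probBest s (D.sel s)) (m : ℕ) :
    ∀ s, c ≤ D.pcs M m s := by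
  induction m with
  | zero => exact hc
  | succ m ih =>
    intro s
    rw [pcs_succ]
    calc c = ∑ i, (D.base (m + 1) s).real {i} * c := by rw [← Finset.sum_mul, sum_base, one_mul]
      _ ≤ _ := Finset.sum_le_sum fun i _ => mul_le_mul_of_nonneg_left
          (D.le_actionValue_of_le_pcs M ih s i) measureReal_nonneg

/-- A bound on the quality of the final selection gives one on all action values. -/
theorem le_actionValue {c : ℝ} (hc : ∀ s, c ≤ M.probBest s (D.sel s)) (m : ℕ) (s : State N)
    (i : Fin N) : c ≤ D.actionValue M m s i :=
  D.le_actionValue_of_le_pcs M (D.le_pcs M hc m) s i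

/-- If the values `pcs m` are bounded away from `1` as long as some alternative has at most `n + 1`
observations, then so are the values of the actions if some alternative has at most `n` of them. -/
theorem actionValue_le_of_pcs_le {R p δ : ℝ} {m n : ℕ} (hδ : 0 ≤ δ)
    (hp : ∀ s : State N, s.MeansBounded R → ∀ i, p ≤ (M.predKernel i s).real (Set.Icc (-R) R))
    (h : ∀ s : State N, s.MeansBounded R → (∃ i, (s i).1 ≤ n + 1) → D.pcs M m s ≤ 1 - δ)
    (s : State N) (hs : s.MeansBounded R) (hn : ∃ i, (s i).1 ≤ n) (i : Fin N) :
    D.actionValue M m s i ≤ 1 - δ * p := by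
  rw [actionValue_eq]
  refine integral_le_one_sub (D.integrable_pcs_update M m s i) measurableSet_Icc hδ
    (fun x => ((D.pcs_measurable_mem M m).2 _).2) (fun x hx => h _ (hs.update i hx) ?_) (hp s hs i)
  obtain ⟨k, hk⟩ := hn
  exact ⟨k, (s.update_count_le i k x).trans (by omega)⟩

/-- For each fixed length `m`, the values `pcs m` are bounded away from `1` as long as some alternative
has few observations. The bound on the number of observations grows by one in each rollout step. -/
theorem exists_pcs_le {R p : ℝ} (hp0 : 0 < p)
    (hp : ∀ s : State N, s.MeansBounded R → ∀ i, p ≤ (M.predKernel i s).real (Set.Icc (-R) R))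
    (hbest : ∀ n : ℕ, ∃ δ : ℝ, 0 < δ ∧ ∀ s : State N, s.MeansBounded R →
      (∃ i, (s i).1 ≤ n) → ∀ k, M.probBest s k ≤ 1 - δ) (m : ℕ) :
    ∀ n : ℕ, ∃ δ : ℝ, 0 < δ ∧ ∀ s : State N, s.MeansBounded R → (∃ i, (s i).1 ≤ n) →
      D.pcs M m s ≤ 1 - δ := by
  induction m with
  | zero =>
    intro n
    obtain ⟨δ, hδ, h⟩ := hbest n
    exact ⟨δ, hδ, fun s hs hn => h s hs hn _⟩
  | succ m ih =>
    intro n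
    obtain ⟨δ, hδ, h⟩ := ih (n + 1)
    refine ⟨δ * p, by positivity, fun s hs hn => ?_⟩
    rw [pcs_succ]
    calc ∑ i, (D.base (m + 1) s).real {i} * D.actionValue M m s i
        ≤ ∑ i, (D.base (m + 1) s).real {i} * (1 - δ * p) :=
          Finset.sum_le_sum fun i _ => mul_le_mul_of_nonneg_left
            (D.actionValue_le_of_pcs_le M hδ.le hp h s hs hn i) measureReal_nonneg
      _ = 1 - δ * p := by rw [← Finset.sum_mul, sum_base, one_mul]

/-- As long as some alternative has few observations, rollouts of bounded length do not succeed
almost certainly: the simulated observations may leave the sample means bounded, and then the final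
selection is uncertain. -/
theorem exists_actionValue_le (hN : 1 < N) (hT : M.FullTails) :
    ∃ R₀ : ℝ, ∀ R, R₀ ≤ R → ∀ n L : ℕ, ∃ δ : ℝ, 0 < δ ∧ ∀ s : State N, s.MeansBounded R →
      (∃ i, (s i).1 ≤ n) → ∀ m ≤ L, ∀ i, D.actionValue M m s i ≤ 1 - δ := by
  obtain ⟨R₁, hR₁, h₁⟩ := M.exists_probBest_le hN hT
  obtain ⟨R₂, hR₂, h₂⟩ := M.exists_pos_le_predKernel
  refine ⟨max R₁ R₂, fun R hR n L => ?_⟩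
  obtain ⟨p, hp0, hp⟩ := h₂ R ((le_max_right _ _).trans hR)
  choose δ hδ h using fun m : ℕ =>
    D.exists_pcs_le M hp0 hp (h₁ R ((le_max_left _ _).trans hR)) m (n + 1)
  obtain ⟨d, hd, hdδ⟩ := exists_pos_le_of_finite (fun m : Fin (L + 1) => δ m) fun m => hδ m
  refine ⟨d * p, by positivity, fun s hs hn m hm i => ?_⟩
  have h3 := D.actionValue_le_of_pcs_le M (hδ m).le hp (h m) s hs hn i
  have h4 : d ≤ δ m := hdδ ⟨m, by omega⟩
  have : d * p ≤ δ m * p := by gcongr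
  linarith

/-! ### The exploration of poorly known alternatives -/

theorem pow_le_rewardProb {q : Fin N → ℝ} {v : D.Rewards} {b : ℝ} (hb : 0 ≤ b)
    (h : ∀ i k, b ≤ if v i k then q i else 1 - q i) : (b ^ D.K) ^ N ≤ D.rewardProb q v := by
  unfold rewardProb
  calc (b ^ D.K) ^ N = ∏ _i : Fin N, ∏ _k : Fin D.K, b := by simp
    _ ≤ _ := Finset.prod_le_prod (fun _ _ => by positivity) fun i _ =>
      Finset.prod_le_prod (fun _ _ => hb) fun k _ => h i k

/-- The tie-breaking rule respects the estimates: a unique maximizer is chosen. -/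
theorem tie_singleton (i : Fin N) : D.tie {i} i = 1 := by
  have h := D.tie_support {i} (Finset.singleton_nonempty i)
  rw [PMF.apply_eq_one_iff]
  refine (Set.Nonempty.subset_singleton_iff (D.tie {i}).support_nonempty).1 ?_
  simpa using h

theorem mem_argmaxSet {f : Fin N → ℝ} {i : Fin N} : i ∈ argmaxSet f ↔ ∀ j, f j ≤ f i := by
  simp [argmaxSet]

theorem argmaxSet_estimate_all : argmaxSet (D.estimate fun _ _ => true) = Finset.univ := by
  ext i; simp [mem_argmaxSet, estimate]

theorem argmaxSet_estimate_only (i : Fin N) :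
    argmaxSet (D.estimate fun j _ => decide (j = i)) = {i} := by
  have hK : (0 : ℝ) < D.K := by exact_mod_cast D.K_pos
  have hi : D.estimate (fun j _ => decide (j = i)) i = 1 := by simp [estimate, hK.ne']
  have hj : ∀ j, j ≠ i → D.estimate (fun j _ => decide (j = i)) j = 0 := fun j hj => by
    simp [estimate, hj]
  ext k
  rw [mem_argmaxSet, Finset.mem_singleton]
  constructor
  · intro h
    by_contra hk
    have := h i
    rw [hi, hj k hk] at this
    linarith
  · rintro rfl j
    rw [hi]
    by_cases h : j = k
    · rw [h, hi]
    · rw [hj j h]; exact zero_le_one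

theorem lookahead_le (hH : D.H ≠ ⊤) (T t : ℕ) : D.lookahead T t ≤ D.H.toNat := by
  have : (min D.H ((T - t : ℕ) : ℕ∞)).toNat ≤ D.H.toNat :=
    ENat.toNat_le_toNat (min_le_left _ _) hH
  unfold lookahead
  omega

/-- As long as alternative `i` has few observations and the sample means are bounded, the
rollout policy samples `i` with a probability that is bounded below. If all ties are broken at
random, then all rewards may be `1`; if the lookahead is bounded, the rewards of `i` may be `1` and
all others `0`. -/
theorem exists_le_stepProb (hN : 1 < N) (hT : M.FullTails)
    (hc : ∃ c : ℝ, 0 < c ∧ ∀ s, c ≤ M.probBest s (D.sel s))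
    (htie : (∀ A : Finset (Fin N), A.Nonempty → (D.tie A).support = A) ∨ D.H ≠ ⊤) (i : Fin N) :
    ∃ (v : D.Rewards) (R₀ : ℝ), ∀ R, R₀ ≤ R → ∀ n : ℕ, ∃ η : ℝ, 0 < η ∧ ∀ (T t : ℕ) (s : State N),
      s.MeansBounded R → (s i).1 ≤ n → η ≤ D.stepProb (D.Q M T t s) v i := by
  obtain ⟨c, hc0, hc⟩ := hc
  rcases htie with htie | hH
  · refine ⟨fun _ _ => true, 0, fun R _ n => ?_⟩
    have ht : 0 < (D.tie Finset.univ i).toReal := by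
      refine ENNReal.toReal_pos ?_ (PMF.apply_ne_top _ _)
      rw [← PMF.mem_support_iff, htie Finset.univ ⟨i, Finset.mem_univ i⟩]
      simp
    refine ⟨(c ^ D.K) ^ N * (D.tie Finset.univ i).toReal, by positivity, fun T t s _ _ => ?_⟩
    rw [stepProb, argmaxSet_estimate_all]
    gcongr
    exact D.pow_le_rewardProb hc0.le fun j k => by
      simpa [Q] using D.le_actionValue M hc _ s j
  · obtain ⟨R₀, hR₀⟩ := D.exists_actionValue_le M hN hT
    refine ⟨fun j _ => decide (j = i), R₀, fun R hR n => ?_⟩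
    obtain ⟨δ, hδ, h⟩ := hR₀ R hR n D.H.toNat
    refine ⟨((min c δ) ^ D.K) ^ N, by positivity, fun T t s hs hn => ?_⟩
    rw [stepProb, argmaxSet_estimate_only, tie_singleton, ENNReal.toReal_one, mul_one]
    refine D.pow_le_rewardProb (by positivity) fun j k => ?_
    by_cases hj : j = i
    · rw [hj]
      simpa [Q] using (min_le_left c δ).trans (D.le_actionValue M hc _ s i)
    · have := h s hs ⟨i, hn⟩ _ (D.lookahead_le hH T t) j
      simp only [hj, decide_false, Bool.false_eq_true, if_false]
      refine (min_le_right _ _).trans ?_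
      unfold Q
      linarith

end Design

/-! ### Normal priors -/

/-- Conjugacy: tilting a normal law by a normal likelihood gives a normal law, with the mean
weighted by the precisions (completion of the square). -/
theorem tilted_gaussianReal {m x : ℝ} {v σ : ℝ≥0} (n : ℕ) (hv : v ≠ 0) (hσ : σ ≠ 0)
    (hf : Integrable (fun θ => Real.exp (-(n * (x - θ) ^ 2) / (2 * σ))) (gaussianReal m v)) :
    (gaussianReal m v).tilted (fun θ => -(n * (x - θ) ^ 2) / (2 * σ))
      = gaussianReal ((m * σ + n * v * x) / (σ + n * v)) (v * σ / (σ + n * v)) := by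
  set f : ℝ → ℝ := fun θ => -(n * (x - θ) ^ 2) / (2 * σ) with hfdef
  have hv' : 0 < (v : ℝ) := NNReal.coe_pos.2 (pos_iff_ne_zero.2 hv)
  have hσ' : 0 < (σ : ℝ) := NNReal.coe_pos.2 (pos_iff_ne_zero.2 hσ)
  have hn : (0 : ℝ) ≤ n := Nat.cast_nonneg n
  have hw0 : 0 < σ + n * v := add_pos_of_pos_of_nonneg (pos_iff_ne_zero.2 hσ) zero_le
  set w : ℝ≥0 := v * σ / (σ + n * v) with hw
  set m' : ℝ := (m * σ + n * v * x) / (σ + n * v) with hm'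
  have hwne : w ≠ 0 := div_ne_zero (mul_ne_zero hv hσ) hw0.ne'
  have hw' : (w : ℝ) = v * σ / (σ + n * v) := by rw [hw]; push_cast; rfl
  have hwpos : 0 < (w : ℝ) := NNReal.coe_pos.2 (pos_iff_ne_zero.2 hwne)
  set Z := ∫ θ, Real.exp (f θ) ∂(gaussianReal m v) with hZ
  have hZpos : 0 < Z := integral_exp_pos hf
  set k : ℝ := n * (x - m) ^ 2 / (2 * (σ + n * v)) with hk
  set C : ℝ := (√(2 * Real.pi * v))⁻¹ * √(2 * Real.pi * w) * Real.exp (-k) / Z with hC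
  have hCpos : 0 < C := by positivity
  have hfm : Measurable f := by fun_prop
  have hpt : ∀ θ, gaussianPDFReal m v θ * (Real.exp (f θ) / Z) = C * gaussianPDFReal m' w θ := by
    intro θ
    have hsq : -(θ - m) ^ 2 / (2 * v) + f θ = -k + -(θ - m') ^ 2 / (2 * w) := by
      rw [hfdef, hk, hm', hw']
      have : (0 : ℝ) < σ + n * v := by positivity
      field_simp
      ring
    rw [gaussianPDFReal, gaussianPDFReal, hC]
    have hs : √(2 * Real.pi * w) ≠ 0 := by positivity
    calc _ = (√(2 * Real.pi * v))⁻¹ * Real.exp (-(θ - m) ^ 2 / (2 * v) + f θ) / Z := by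
          rw [Real.exp_add]; ring
      _ = _ := by rw [hsq, Real.exp_add]; field_simp
  have hmeas : (gaussianReal m v).tilted f = ENNReal.ofReal C • gaussianReal m' w := by
    rw [Measure.tilted, gaussianReal_of_var_ne_zero _ hv, gaussianReal_of_var_ne_zero _ hwne,
      ← withDensity_smul _ (measurable_gaussianPDF m' w),
      ← withDensity_mul _ (measurable_gaussianPDF m v) (by fun_prop)]
    congr 1
    funext θ
    rw [← gaussianReal_of_var_ne_zero _ hv]
    simp only [Pi.mul_apply, Pi.smul_apply, smul_eq_mul, gaussianPDF]
    rw [← ENNReal.ofReal_mul (gaussianPDFReal_nonneg _ _ _), ← ENNReal.ofReal_mul hCpos.le,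
      ← hpt θ]
  have : IsProbabilityMeasure ((gaussianReal m v).tilted f) := isProbabilityMeasure_tilted hf
  have h1 : ENNReal.ofReal C = 1 := by
    have := congrArg (fun ρ : Measure ℝ => ρ Set.univ) hmeas
    simpa using this.symm
  rw [hmeas, h1, one_smul]

/-- The mean of a normal law is a median. -/
theorem half_le_gaussianReal (m : ℝ) (v : ℝ≥0) :
    1 / 2 ≤ (gaussianReal m v).real (Set.Ici m) ∧ 1 / 2 ≤ (gaussianReal m v).real (Set.Iic m) := by
  have hmap : (gaussianReal m v).map (fun x => 2 * m - x) = gaussianReal m v := by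
    rw [gaussianReal_map_const_sub]; congr 1; ring
  have h1 : (gaussianReal m v).real (Set.Ici m) = (gaussianReal m v).real (Set.Iic m) := by
    conv_lhs => rw [← hmap]
    rw [map_measureReal_apply (by fun_prop) measurableSet_Ici]
    congr 1
    ext x
    simp only [Set.mem_preimage, Set.mem_Ici, Set.mem_Iic]
    constructor <;> intro h <;> linarith
  have h2 : 1 ≤ (gaussianReal m v).real (Set.Ici m) + (gaussianReal m v).real (Set.Iic m) := by
    calc 1 = (gaussianReal m v).real (Set.Ici m ∪ Set.Iic m) := by
          rw [Set.Ici_union_Iic, probReal_univ]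
      _ ≤ _ := measureReal_union_le _ _
  constructor <;> linarith

namespace Problem

variable {N : ℕ} {M : Problem N}

theorem NormalPriors.post_eq (h : M.NormalPriors) (hT : M.FullTails) (i : Fin N) :
    ∃ (m : ℝ) (v : ℝ≥0), v ≠ 0 ∧ ∀ s : State N, M.post s i
      = gaussianReal ((m * M.obsVar i + (s i).1 * v * (s i).2.1) / (M.obsVar i + (s i).1 * v))
        (v * M.obsVar i / (M.obsVar i + (s i).1 * v)) := by
  obtain ⟨m, v, hp⟩ := h
  have hv : v i ≠ 0 := by
    intro hv
    have := (hT i (m i)).1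
    rw [hp i, hv, gaussianReal_zero_var] at this
    simp [measureReal_def] at this
  refine ⟨m i, v i, hv, fun s => ?_⟩
  have hint := M.integrable_exp_logLik s i
  rw [hp i] at hint
  rw [Problem.post, hp i]
  exact tilted_gaussianReal _ hv (M.obsVar_ne_zero i) hint

/-- The posterior means are medians of the posterior laws, so the alternative with the largest one
beats each of the others with probability at least one half. -/
theorem SelectsMaxMean.exists_le {sel : State N → Fin N} (h : M.SelectsMaxMean sel)
    (hM : M.NormalPriors) (hT : M.FullTails) :
    ∃ c : ℝ, 0 < c ∧ ∀ s, c ≤ M.probBest s (sel s) := by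
  have hhalf : ∀ s i, 1 / 2 ≤ (M.post s i).real (Set.Ici (M.postMean s i)) ∧
      1 / 2 ≤ (M.post s i).real (Set.Iic (M.postMean s i)) := by
    intro s i
    obtain ⟨m, v, -, hpost⟩ := hM.post_eq hT i
    rw [postMean, hpost s, integral_id_gaussianReal]
    exact half_le_gaussianReal _ _
  refine ⟨(1 / 2) ^ N, by positivity, fun s => ?_⟩
  refine M.pow_le_probBest s (sel s) (fun j => if j = sel s then Set.Ici (M.postMean s (sel s))
    else Set.Iic (M.postMean s (sel s))) (by norm_num) (fun j => ?_) fun θ hθ j => ?_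
  · by_cases hj : j = sel s
    · simpa [hj] using (hhalf s (sel s)).1
    · simp only [hj, if_false]
      exact (hhalf s j).2.trans (measureReal_mono (Set.Iic_subset_Iic.2 (h s j)))
  · by_cases hj : j = sel s
    · rw [hj]
    · have h1 := hθ (sel s)
      have h2 := hθ j
      simp only [if_true, hj, if_false, Set.mem_Ici, Set.mem_Iic] at h1 h2
      exact h2.trans h1

/-- Under normal priors the posterior mean has the same limit as the sample mean. -/
theorem NormalPriors.tendsto_postMean (hM : M.NormalPriors) (hT : M.FullTails) (i : Fin N) {c : ℝ}
    {u : ℕ → State N} (hn : Tendsto (fun T => (u T i).1) atTop atTop)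
    (hm : Tendsto (fun T => (u T i).2.1) atTop (𝓝 c)) :
    Tendsto (fun T => M.postMean (u T) i) atTop (𝓝 c) := by
  obtain ⟨m, v, hv, hpost⟩ := hM.post_eq hT i
  have hv' : 0 < (v : ℝ) := NNReal.coe_pos.2 (pos_iff_ne_zero.2 hv)
  have hσ := M.obsVar_pos i
  have heq : ∀ T, M.postMean (u T) i = (u T i).2.1
      + M.obsVar i * (m - (u T i).2.1) / (M.obsVar i + (u T i).1 * v) := by
    intro T
    rw [postMean, hpost (u T), integral_id_gaussianReal]
    have : (0 : ℝ) < M.obsVar i + (u T i).1 * v := by positivity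
    field_simp
    ring
  simp only [heq]
  have hden : Tendsto (fun T => (M.obsVar i : ℝ) + (u T i).1 * v) atTop atTop :=
    tendsto_atTop_add_const_left _ _
      ((tendsto_natCast_atTop_atTop.comp hn).atTop_mul_const hv')
  simpa using hm.add (((tendsto_const_nhds.sub hm).const_mul (M.obsVar i : ℝ)).div_atTop hden)

/-! ### Concentration of the posterior laws -/

/-- Posterior consistency: if the sample mean of alternative `i` tends to a point `c` of the support
of the prior, then the posterior law concentrates at `c`. -/
theorem tendsto_post_Ioo (M : Problem N) (i : Fin N) {c : ℝ} (hc : c ∈ (M.prior i).support)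
    {u : ℕ → State N} (hn : Tendsto (fun T => (u T i).1) atTop atTop)
    (hm : Tendsto (fun T => (u T i).2.1) atTop (𝓝 c)) {ε : ℝ} (hε : 0 < ε) :
    Tendsto (fun T => (M.post (u T) i).real (Set.Ioo (c - ε) (c + ε))) atTop (𝓝 1) := by
  have hv := M.obsVar_pos i
  set B : Set ℝ := Set.Ioo (c - ε / 4) (c + ε / 4) with hB
  have hBpos : 0 < (M.prior i).real B :=
    ENNReal.toReal_pos ((Measure.mem_support_iff_forall c).1 hc B
      (Ioo_mem_nhds (by linarith) (by linarith))).ne' (measure_ne_top _ _)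
  -- Beyond distance `ε` the squared deviation from the sample mean is at least `(3ε/4)²`, while on
  -- `B` it is at most `(ε/2)²`.
  have hbound : ∀ᶠ T in atTop, (M.post (u T) i).real (Set.Ioo (c - ε) (c + ε))ᶜ
      ≤ Real.exp (-((u T i).1 * (5 * ε ^ 2 / (32 * M.obsVar i)))) / (M.prior i).real B := by
    filter_upwards [hm (Ioo_mem_nhds (by linarith : c - ε / 4 < c) (by linarith : c < c + ε / 4))]
      with T hT
    have hT1 : c - ε / 4 < (u T i).2.1 := hT.1
    have hT2 : (u T i).2.1 < c + ε / 4 := hT.2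
    have key := tilted_real_mul_le (M.integrable_exp_logLik (u T) i)
      (A := (Set.Ioo (c - ε) (c + ε))ᶜ) (B := B) measurableSet_Ioo.compl measurableSet_Ioo
      (α := -((u T i).1 * (3 * ε / 4) ^ 2) / (2 * M.obsVar i))
      (β := -((u T i).1 * (ε / 2) ^ 2) / (2 * M.obsVar i))
      (by
        intro θ hθ
        unfold logLik
        have : (3 * ε / 4) ^ 2 ≤ ((u T i).2.1 - θ) ^ 2 := by
          rw [sq_le_sq, abs_of_pos (by linarith : 0 < 3 * ε / 4)]
          by_cases h : c - ε < θ
          · have : c + ε ≤ θ := by by_contra h'; exact hθ ⟨h, not_le.1 h'⟩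
            rw [abs_of_nonpos (by linarith)]; linarith
          · rw [abs_of_nonneg (by linarith)]; linarith
        gcongr)
      (by
        intro θ hθ
        unfold logLik
        have : ((u T i).2.1 - θ) ^ 2 ≤ (ε / 2) ^ 2 :=
          sq_le_sq' (by linarith [hθ.2]) (by linarith [hθ.1])
        gcongr)
    rw [← Problem.post_eq] at key
    rw [le_div_iff₀ hBpos]
    refine key.trans ?_
    have h1 : (M.prior i).real (Set.Ioo (c - ε) (c + ε))ᶜ * (M.post (u T) i).real B ≤ 1 :=
      mul_le_one₀ measureReal_le_one measureReal_nonneg measureReal_le_one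
    refine (mul_le_of_le_one_right (Real.exp_pos _).le h1).trans (le_of_eq ?_)
    congr 1
    field_simp
    ring
  have hlim : Tendsto (fun T => Real.exp (-((u T i).1 * (5 * ε ^ 2 / (32 * M.obsVar i))))
      / (M.prior i).real B) atTop (𝓝 0) := by
    have h1 : Tendsto (fun T => ((u T i).1 : ℝ) * (5 * ε ^ 2 / (32 * M.obsVar i))) atTop atTop :=
      (tendsto_natCast_atTop_atTop.comp hn).atTop_mul_const (by positivity)
    simpa using (Real.tendsto_exp_neg_atTop_nhds_zero.comp h1).div_const ((M.prior i).real B)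
  have hcompl := tendsto_of_tendsto_of_tendsto_of_le_of_le' tendsto_const_nhds hlim
    (Eventually.of_forall fun T => measureReal_nonneg) hbound
  have h2 := hcompl.const_sub 1
  rw [sub_zero] at h2
  refine h2.congr fun T => ?_
  rw [probReal_compl_eq_one_sub measurableSet_Ioo]
  ring

/-- If every alternative has more and more observations and the sample means tend to points `c j` of
the supports of the priors, then the best alternative of `c` is eventually selected. -/
theorem eventually_sel_eq (hT : M.FullTails) {sel : State N → Fin N}
    (hsel : M.SelectsMaxProb sel ∨ (M.NormalPriors ∧ M.SelectsMaxMean sel))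
    {c : Fin N → ℝ} (hc : ∀ j, c j ∈ (M.prior j).support) {u : ℕ → State N}
    (hn : ∀ j, Tendsto (fun T => (u T j).1) atTop atTop)
    (hm : ∀ j, Tendsto (fun T => (u T j).2.1) atTop (𝓝 (c j)))
    {i : Fin N} (hi : ∀ j, j ≠ i → c j < c i) : ∀ᶠ T in atTop, sel (u T) = i := by
  rcases hsel with hsel | ⟨hM, hsel⟩
  · obtain ⟨δ, hδ, hgap⟩ := exists_pos_le_of_finite (fun j : {j // j ≠ i} => c i - c j)
      fun j => sub_pos.2 (hi j j.2)
    have h1 : Tendsto (fun q : ℝ => q ^ N) (𝓝[<] 1) (𝓝 (1 ^ N)) :=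
      ((continuous_pow N).tendsto 1).mono_left nhdsWithin_le_nhds
    have h2 : ∀ᶠ q in 𝓝[<] (1 : ℝ), 1 / 2 < q ^ N ∧ 0 ≤ q ∧ q < 1 := by
      filter_upwards [h1.eventually (lt_mem_nhds (by norm_num : (1 / 2 : ℝ) < 1 ^ N)),
        Ioo_mem_nhdsLT (by norm_num : (0 : ℝ) < 1)] with q hq hq'
      exact ⟨hq, hq'.1.le, hq'.2⟩
    obtain ⟨q, hqN, hq0, hq1⟩ := h2.exists
    have h3 : ∀ᶠ T in atTop, ∀ j,
        q < (M.post (u T) j).real (Set.Ioo (c j - δ / 2) (c j + δ / 2)) :=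
      eventually_all.2 fun j =>
        (M.tendsto_post_Ioo j (hc j) (hn j) (hm j) (half_pos hδ)).eventually (lt_mem_nhds hq1)
    filter_upwards [h3] with T hT3
    refine hsel.eq_of_concentrated (u T) c (ε := δ / 2) (fun j hj => ?_) hq0 hqN
      fun j => (hT3 j).le
    have := hgap ⟨j, hj⟩
    simp only at this
    linarith
  · have h1 : ∀ᶠ T in atTop, ∀ j, j ≠ i → M.postMean (u T) j < M.postMean (u T) i := by
      refine eventually_all.2 fun j => ?_
      by_cases hj : j = i
      · exact Eventually.of_forall fun T h => absurd hj h
      · filter_upwards [(hM.tendsto_postMean hT j (hn j) (hm j)).eventually_lt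
          (hM.tendsto_postMean hT i (hn i) (hm i)) (hi j hj)] with T hlt _ using hlt
    filter_upwards [h1] with T hlt
    by_contra hne
    exact absurd (hsel (u T) i) (not_le.2 (hlt _ hne))

end Problem

/-! ### The statistics along a run -/

section stateAfter

variable {N : ℕ} (y : Fin N → ℕ → ℝ) (b : ℕ → Fin N)

theorem stateAfter_count (t : ℕ) (i : Fin N) :
    (stateAfter y b t i).1 = ∑ u : Fin t, if b u = i then 1 else 0 := by
  induction t with
  | zero => simp [stateAfter, State.init]
  | succ t ih =>
    rw [Fin.sum_univ_castSucc, stateAfter]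
    simp only [Fin.val_castSucc, Fin.val_last]
    by_cases h : b t = i
    · subst h; rw [State.update_count_self, ih]; simp
    · rw [State.update_of_ne _ (Ne.symm h), ih]; simp [h]

/-- With the convention `0 / 0 = 0`, this includes alternatives without observations. -/
theorem stateAfter_mean (t : ℕ) (i : Fin N) :
    (stateAfter y b t i).2.1
      = (∑ k ∈ Finset.range (stateAfter y b t i).1, y i k) / (stateAfter y b t i).1 := by
  induction t with
  | zero => simp [stateAfter, State.init]
  | succ t ih =>
    rw [stateAfter]
    by_cases h : b t = i
    · subst h
      rw [State.update_count_self, Finset.sum_range_succ]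
      simp only [State.update, Function.update_self]
      push_cast
      congr 2
      rw [ih]
      by_cases h0 : (stateAfter y b t (b t)).1 = 0
      · simp [h0]
      · have : ((stateAfter y b t (b t)).1 : ℝ) ≠ 0 := by exact_mod_cast h0
        field_simp
    · rw [State.update_of_ne _ (Ne.symm h)]
      exact ih

end stateAfter

/-- All averages of successive observations are in `[-R, R]`. -/
def AveragesBounded {N : ℕ} (R : ℝ) (y : Fin N → ℕ → ℝ) : Prop :=
  ∀ i n, |(∑ k ∈ Finset.range n, y i k) / n| ≤ R

theorem AveragesBounded.meansBounded {N : ℕ} {R : ℝ} {y : Fin N → ℕ → ℝ}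
    (h : AveragesBounded R y) (b : ℕ → Fin N) (t : ℕ) : (stateAfter y b t).MeansBounded R := by
  intro k
  rw [stateAfter_mean]
  exact h k _

theorem measurableSet_averagesBounded {N : ℕ} (R : ℝ) :
    MeasurableSet {y : Fin N → ℕ → ℝ | AveragesBounded R y} := by
  simp only [AveragesBounded, Set.ofPred_forall]
  refine MeasurableSet.iInter fun i => MeasurableSet.iInter fun n => measurableSet_le ?_ (by fun_prop)
  have : Measurable fun y : Fin N → ℕ → ℝ => ∑ k ∈ Finset.range n, y i k :=
    Finset.measurable_sum _ fun k _ => by fun_prop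
  exact (this.div_const _).abs

/-! ### Every alternative is sampled infinitely often -/

section Counts

variable {N : ℕ} {M : Problem N} {D : Design N} {Ω : Type*} {μ : Fin N → Ω → ℝ}
  {Y : Fin N → ℕ → Ω → ℝ} {r : ℕ → ℕ → Ω → D.Rewards} {a : ℕ → ℕ → Ω → Fin N}

open Classical in
/-- A weight that decreases when alternative `i` is sampled: `2⁻ᶜ` if there are `c ≤ n` observations
of `i` after `t` steps and the averages of the observations are bounded by `R`, and `0` otherwise. -/
def weight (Y : Fin N → ℕ → Ω → ℝ) (a : ℕ → ℕ → Ω → Fin N) (R : ℝ) (n : ℕ) (i : Fin N) (T t : ℕ)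
    (ω : Ω) : ℝ :=
  if AveragesBounded R (fun j k => Y j k ω) ∧ (runState Y a T t ω i).1 ≤ n then
    (1 / 2) ^ (runState Y a T t ω i).1 else 0

theorem weight_mem_Icc (R : ℝ) (n : ℕ) (i : Fin N) (T t : ℕ) (ω : Ω) :
    weight Y a R n i T t ω ∈ Set.Icc (0 : ℝ) 1 := by
  unfold weight
  split_ifs
  · exact ⟨by positivity, pow_le_one₀ (by norm_num) (by norm_num)⟩
  · exact ⟨le_rfl, zero_le_one⟩

theorem measurable_weight_past (R : ℝ) (n : ℕ) (i : Fin N) (T t : ℕ) :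
    Measurable[past D μ Y r a T t] (weight Y a R n i T t) := by
  classical
  let count : (Fin N → ℝ) × (Fin N → ℕ → ℝ) × (Fin t → D.Rewards × Fin N) → ℕ :=
    fun p => ∑ u : Fin t, if (p.2.2 u).2 = i then 1 else 0
  let g : (Fin N → ℝ) × (Fin N → ℕ → ℝ) × (Fin t → D.Rewards × Fin N) → ℝ :=
    fun p => if AveragesBounded R p.2.1 ∧ count p ≤ n then (1 / 2) ^ count p else 0
  have hcount : Measurable count := by
    refine Finset.measurable_sum _ fun u _ => Measurable.ite ?_ measurable_const measurable_const
    have : Measurable fun p : (Fin N → ℝ) × (Fin N → ℕ → ℝ) × (Fin t → D.Rewards × Fin N) =>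
        (p.2.2 u).2 := by fun_prop
    exact this (measurableSet_singleton i)
  have hg : Measurable g := by
    refine Measurable.ite (MeasurableSet.inter ?_ ?_) ?_ measurable_const
    · exact measurable_snd.fst (measurableSet_averagesBounded R)
    · exact hcount measurableSet_Iic
    · exact (measurable_of_countable fun c : ℕ => (1 / 2 : ℝ) ^ c).comp hcount
  have heq : weight Y a R n i T t = g ∘ fun ω => ((fun i => μ i ω), (fun i n => Y i n ω),
      (fun u : Fin t => (r T u ω, a T u ω))) := by
    funext ω
    simp only [weight, runState, stateAfter_count, Function.comp, g, count]
  rw [heq]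
  exact hg.comp (comap_measurable _)

theorem weight_succ_le (R : ℝ) (n : ℕ) (i : Fin N) (v : D.Rewards) (T t : ℕ) (ω : Ω) :
    weight Y a R n i T (t + 1) ω ≤ weight Y a R n i T t ω - 1 / 2 * (weight Y a R n i T t ω *
      Set.indicator {ω | r T t ω = v ∧ a T t ω = i} (fun _ => (1 : ℝ)) ω) := by
  have h0 := (weight_mem_Icc (Y := Y) (a := a) R n i T t ω).1
  by_cases h : a T t ω = i
  · have hcount : (runState Y a T (t + 1) ω i).1 = (runState Y a T t ω i).1 + 1 := by
      simp only [runState, stateAfter]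
      rw [← h, State.update_count_self]
    have h1 : weight Y a R n i T (t + 1) ω ≤ 1 / 2 * weight Y a R n i T t ω := by
      unfold weight
      rw [hcount]
      split_ifs with h1 h2 h2
      · rw [pow_succ, mul_comm]
      · exact absurd ⟨h1.1, by omega⟩ h2
      · positivity
      · simp
    have h2 : Set.indicator {ω | r T t ω = v ∧ a T t ω = i} (fun _ => (1 : ℝ)) ω ≤ 1 :=
      Set.indicator_le_self' (fun _ _ => zero_le_one) ω
    nlinarith
  · have h1 : weight Y a R n i T (t + 1) ω = weight Y a R n i T t ω := by
      have hi : runState Y a T (t + 1) ω i = runState Y a T t ω i :=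
        State.update_of_ne _ (Ne.symm h) _
      unfold weight
      rw [hi]
    have h2 : ω ∉ {ω | r T t ω = v ∧ a T t ω = i} := fun h' => h h'.2
    rw [h1, Set.indicator_of_notMem h2]
    simp

variable [MeasurableSpace Ω] {P : Measure Ω}

theorem past_le (hmodel : FollowsModel M P μ Y)
    (hroll : IsRollout M D P μ Y r a) (T t : ℕ) :
    past D μ Y r a T t ≤ (inferInstance : MeasurableSpace Ω) := by
  refine Measurable.comap_le ?_
  refine (measurable_pi_iff.2 hmodel.measurable_mean).prodMk (Measurable.prodMk ?_ ?_)
  · exact measurable_pi_iff.2 fun i => measurable_pi_iff.2 fun n => hmodel.measurable_obs i n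
  · exact measurable_pi_iff.2 fun u =>
      (hroll.measurable_rewards T u).prodMk (hroll.measurable_action T u)

theorem integrable_weight [IsProbabilityMeasure P] (hmodel : FollowsModel M P μ Y)
    (hroll : IsRollout M D P μ Y r a) (R : ℝ) (n : ℕ) (i : Fin N) (T t : ℕ) :
    Integrable (weight Y a R n i T t) P :=
  Design.integrable_of_mem_Icc
    ((measurable_weight_past (D := D) (μ := μ) (r := r) R n i T t).mono
      (past_le hmodel hroll T t) le_rfl)
    fun ω => weight_mem_Icc R n i T t ω

/-- If `i` is sampled with conditional probability at least `η` as long as it has few observations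
and the averages of the observations are bounded, then the expected weight decays geometrically. -/
theorem integral_weight_le [IsProbabilityMeasure P] (hmodel : FollowsModel M P μ Y)
    (hroll : IsRollout M D P μ Y r a) {R η : ℝ} {n : ℕ} {i : Fin N} {v : D.Rewards} (hη1 : η ≤ 1)
    (h : ∀ (T t : ℕ) (s : State N), s.MeansBounded R → (s i).1 ≤ n →
      η ≤ D.stepProb (D.Q M T t s) v i) (T : ℕ) :
    ∀ t ≤ T, ∫ ω, weight Y a R n i T t ω ∂P ≤ (1 - η / 2) ^ t := by
  intro t
  induction t with
  | zero =>
    intro _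
    calc ∫ ω, weight Y a R n i T 0 ω ∂P ≤ ∫ _, (1 : ℝ) ∂P :=
          integral_mono (integrable_weight hmodel hroll R n i T 0) (integrable_const _)
            fun ω => (weight_mem_Icc R n i T 0 ω).2
      _ = _ := by simp
  | succ t ih =>
    intro ht
    have ih := ih (by omega)
    set W := weight Y a R n i T t with hW
    set I : Ω → ℝ := Set.indicator {ω | r T t ω = v ∧ a T t ω = i} (fun _ => (1 : ℝ)) with hI
    have hWint : Integrable W P := integrable_weight hmodel hroll R n i T t
    have hset : MeasurableSet {ω | r T t ω = v ∧ a T t ω = i} :=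
      (hroll.measurable_rewards T t (measurableSet_singleton v)).inter
        (hroll.measurable_action T t (measurableSet_singleton i))
    have hIint : Integrable I P := (integrable_const (1 : ℝ)).indicator hset
    have hWI : Integrable (W * I) P := by
      refine hIint.bdd_mul hWint.aestronglyMeasurable (c := 1) (ae_of_all _ fun ω => ?_)
      have := weight_mem_Icc (Y := Y) (a := a) R n i T t ω
      rw [Real.norm_eq_abs, abs_of_nonneg this.1]
      exact this.2
    have hm := past_le hmodel hroll T t
    have hpull : P[W * I | past D μ Y r a T t] =ᵐ[P]
        fun ω => W ω * D.stepProb (D.Q M T t (runState Y a T t ω)) v i := by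
      have h1 := condExp_mul_of_stronglyMeasurable_left
        (measurable_weight_past (Y := Y) (a := a) (D := D) (μ := μ) (r := r) R n i T t).stronglyMeasurable
        hWI hIint
      filter_upwards [h1, hroll.law_step T t (by omega) v i] with ω hω1 hω2
      rw [hω1, Pi.mul_apply, hω2]
    have hlow : η * ∫ ω, W ω ∂P ≤ ∫ ω, (W * I) ω ∂P := by
      rw [← integral_condExp (f := W * I) hm, integral_congr_ae hpull, ← integral_const_mul]
      refine integral_mono (hWint.const_mul η) (integrable_condExp.congr hpull) fun ω => ?_
      simp only
      by_cases hω : AveragesBounded R (fun j k => Y j k ω) ∧ (runState Y a T t ω i).1 ≤ n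
      · rw [mul_comm]
        exact mul_le_mul_of_nonneg_left (h T t _ (hω.1.meansBounded _ t) hω.2)
          (weight_mem_Icc R n i T t ω).1
      · have : W ω = 0 := by rw [hW, weight, if_neg hω]
        simp [this]
    calc ∫ ω, weight Y a R n i T (t + 1) ω ∂P ≤ ∫ ω, (W ω - 1 / 2 * (W * I) ω) ∂P :=
          integral_mono (integrable_weight hmodel hroll R n i T (t + 1))
            (hWint.sub (hWI.const_mul _)) fun ω => weight_succ_le R n i v T t ω
      _ = ∫ ω, W ω ∂P - 1 / 2 * ∫ ω, (W * I) ω ∂P := by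
          rw [integral_sub hWint (hWI.const_mul _), integral_const_mul]
      _ ≤ (1 - η / 2) * ∫ ω, W ω ∂P := by linarith
      _ ≤ (1 - η / 2) * (1 - η / 2) ^ t := by gcongr; linarith
      _ = (1 - η / 2) ^ (t + 1) := by ring

/-- The Borel-Cantelli lemma for the events that `i` has at most `n` observations at the end of the
run: their probabilities decay geometrically in the budget, by Markov's inequality for the weight. -/
theorem ae_eventually_lt_count [IsProbabilityMeasure P] (hmodel : FollowsModel M P μ Y)
    (hroll : IsRollout M D P μ Y r a) {R η : ℝ} {n : ℕ} {i : Fin N} {v : D.Rewards} (hη : 0 < η)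
    (h : ∀ (T t : ℕ) (s : State N), s.MeansBounded R → (s i).1 ≤ n →
      η ≤ D.stepProb (D.Q M T t s) v i) :
    ∀ᵐ ω ∂P, AveragesBounded R (fun j k => Y j k ω) →
      ∀ᶠ T in atTop, n < (runState Y a T T ω i).1 := by
  set η' := min η 1 with hη'
  have hη'0 : 0 < η' := lt_min hη one_pos
  have hη'1 : η' ≤ 1 := min_le_right _ _
  have hdecay := fun T => integral_weight_le hmodel hroll hη'1
    (fun T t s h1 h2 => (min_le_left η 1).trans (h T t s h1 h2)) T T le_rfl
  have hbound : ∀ T, P {ω | AveragesBounded R (fun j k => Y j k ω) ∧ (runState Y a T T ω i).1 ≤ n}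
      ≤ ENNReal.ofReal (2 ^ n * (1 - η' / 2) ^ T) := by
    intro T
    have h1 := mul_meas_ge_le_integral_of_nonneg
      (ae_of_all P fun ω => (weight_mem_Icc (Y := Y) (a := a) R n i T T ω).1)
      (integrable_weight hmodel hroll R n i T T) ((1 / 2) ^ n)
    have h2 : P.real {ω | (1 / 2) ^ n ≤ weight Y a R n i T T ω} ≤ 2 ^ n * (1 - η' / 2) ^ T := by
      have h3 := h1.trans (hdecay T)
      rw [one_div, inv_pow, inv_mul_le_iff₀ (by positivity)] at h3
      simpa using h3
    refine le_trans (measure_mono fun ω hω => ?_)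
      ((ENNReal.le_ofReal_iff_toReal_le (measure_ne_top _ _) (measureReal_nonneg.trans h2)).2 h2)
    have hω' : AveragesBounded R (fun j k => Y j k ω) ∧ (runState Y a T T ω i).1 ≤ n := hω
    change (1 / 2) ^ n ≤ weight Y a R n i T T ω
    rw [weight, if_pos hω']
    exact pow_le_pow_of_le_one (by norm_num) (by norm_num) hω'.2
  have hsum : Summable fun T : ℕ => 2 ^ n * (1 - η' / 2) ^ T :=
    (summable_geometric_of_lt_one (by linarith) (by linarith)).mul_left _
  have hne : ∑' T, P {ω | AveragesBounded R (fun j k => Y j k ω) ∧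
      (runState Y a T T ω i).1 ≤ n} ≠ ⊤ :=
    ne_top_of_le_ne_top hsum.tsum_ofReal_ne_top (ENNReal.tsum_le_tsum hbound)
  filter_upwards [ae_eventually_notMem hne] with ω hω hB
  filter_upwards [hω] with T hT
  by_contra hle
  exact hT ⟨hB, not_lt.1 hle⟩

/-- Exploration forces the number of observations of every alternative to infinity on all paths with
bounded averages. -/
theorem ae_tendsto_count [IsProbabilityMeasure P] (hmodel : FollowsModel M P μ Y)
    (hroll : IsRollout M D P μ Y r a)
    (h : ∀ i, ∃ (v : D.Rewards) (R₀ : ℝ), ∀ R, R₀ ≤ R → ∀ n : ℕ, ∃ η : ℝ, 0 < η ∧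
      ∀ (T t : ℕ) (s : State N), s.MeansBounded R → (s i).1 ≤ n →
        η ≤ D.stepProb (D.Q M T t s) v i) :
    ∀ᵐ ω ∂P, (∃ R, AveragesBounded R (fun j k => Y j k ω)) →
      ∀ i, Tendsto (fun T => (runState Y a T T ω i).1) atTop atTop := by
  choose v R₀ h using h
  have hall : ∀ᵐ ω ∂P, ∀ (i : Fin N) (n R : ℕ), R₀ i ≤ R →
      AveragesBounded R (fun j k => Y j k ω) → ∀ᶠ T in atTop, n < (runState Y a T T ω i).1 := by
    refine ae_all_iff.2 fun i => ae_all_iff.2 fun n => ae_all_iff.2 fun R => ?_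
    by_cases hR : R₀ i ≤ R
    · obtain ⟨η, hη, hstep⟩ := h i R hR n
      filter_upwards [ae_eventually_lt_count hmodel hroll hη hstep] with ω hω _ using hω
    · exact ae_of_all _ fun ω h' => absurd h' hR
  filter_upwards [hall] with ω hω ⟨R, hR⟩ i
  obtain ⟨R', hR'⟩ := exists_nat_ge (max R (R₀ i))
  refine tendsto_atTop.2 fun n => ?_
  filter_upwards [hω i n R' ((le_max_right _ _).trans hR')
    fun j k => (hR j k).trans ((le_max_left _ _).trans hR')] with T hT using hT.le

end Counts

/-! ### The true means -/

section Model

variable {N : ℕ} {M : Problem N} {Ω : Type*} [MeasurableSpace Ω] {P : Measure Ω}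
  {μ : Fin N → Ω → ℝ} {Y : Fin N → ℕ → Ω → ℝ}

theorem FollowsModel.ae_tendsto_average [IsProbabilityMeasure P] (h : FollowsModel M P μ Y)
    (i : Fin N) :
    ∀ᵐ ω ∂P, Tendsto (fun n : ℕ => (∑ k ∈ Finset.range n, Y i k ω) / n) atTop (𝓝 (μ i ω)) := by
  have hmeas : ∀ n, Measurable fun ω => Y i n ω - μ i ω := fun n =>
    (h.measurable_obs i n).sub (h.measurable_mean i)
  have hid : Integrable (fun x : ℝ => x) (P.map fun ω => Y i 0 ω - μ i ω) := by
    rw [h.law_noise i 0]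
    exact (memLp_id_gaussianReal 1).integrable le_rfl
  have hint : Integrable (fun ω => Y i 0 ω - μ i ω) P :=
    (integrable_map_measure aestronglyMeasurable_id (hmeas 0).aemeasurable).1 hid
  have hzero : ∫ ω, (Y i 0 ω - μ i ω) ∂P = 0 := by
    rw [← integral_map (f := fun x : ℝ => x) (hmeas 0).aemeasurable aestronglyMeasurable_id,
      h.law_noise i 0,
      integral_id_gaussianReal]
  have hslln := strong_law_ae_real (fun n ω => Y i n ω - μ i ω) hint
    (fun m n hmn => h.indep.indepFun (i := Sum.inr (i, m)) (j := Sum.inr (i, n))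
      (by simpa using hmn))
    fun n => ⟨(hmeas n).aemeasurable, (hmeas 0).aemeasurable,
      by rw [h.law_noise i n, h.law_noise i 0]⟩
  filter_upwards [hslln] with ω hω
  rw [hzero] at hω
  have h1 := hω.add_const (μ i ω)
  rw [zero_add] at h1
  refine h1.congr' ?_
  filter_upwards [eventually_gt_atTop 0] with n hn
  have : (n : ℝ) ≠ 0 := by exact_mod_cast hn.ne'
  rw [Finset.sum_sub_distrib, Finset.sum_const, Finset.card_range, nsmul_eq_mul]
  field_simp
  ring

theorem FollowsModel.ae_mem_support (h : FollowsModel M P μ Y) (i : Fin N) :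
    ∀ᵐ ω ∂P, μ i ω ∈ (M.prior i).support := by
  have h1 : ∀ᵐ x ∂(P.map (μ i)), x ∈ (M.prior i).support := by
    rw [h.law_mean i]
    exact Measure.support_mem_ae
  exact ae_of_ae_map (h.measurable_mean i).aemeasurable h1

theorem exists_averagesBounded {y : Fin N → ℕ → ℝ} {c : Fin N → ℝ}
    (h : ∀ i, Tendsto (fun n : ℕ => (∑ k ∈ Finset.range n, y i k) / n) atTop (𝓝 (c i))) :
    ∃ R, AveragesBounded R y := by
  choose R hR using fun i => (h i).abs.bddAbove_range
  refine ⟨∑ i, |R i|, fun i n => ?_⟩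
  calc _ ≤ R i := hR i ⟨n, rfl⟩
    _ ≤ |R i| := le_abs_self _
    _ ≤ _ := Finset.single_le_sum (f := fun i => |R i|) (fun _ _ => abs_nonneg _) (Finset.mem_univ i)

/-- Without observations the posterior is the prior, so the condition on the posterior tails for the
budget `0` says that the priors charge all half-lines. -/
theorem NondegenerateTails.fullTails [IsProbabilityMeasure P] {a : ℕ → ℕ → Ω → Fin N}
    (h : NondegenerateTails M P Y a) : M.FullTails := by
  obtain ⟨ω, hω⟩ := h.exists
  have hpost : ∀ i, M.post (runState Y a 0 0 ω) i = M.prior i := by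
    intro i
    simp [Problem.post, runState, stateAfter, State.init]
  have key : ∀ i x, 0 < (M.prior i).real (Set.Ioi x) ∧ (M.prior i).real (Set.Ioi x) < 1 := by
    intro i x
    obtain ⟨ε, hε, hT⟩ := hω i x 0
    have := hT 0 (by simp [runState, stateAfter, State.init])
    rw [hpost] at this
    constructor <;> linarith [this.1, this.2]
  refine fun i x => ⟨(key i x).1, ?_⟩
  have h1 := (key i (x - 1)).2
  have h2 : (M.prior i).real (Set.Iic (x - 1)) = 1 - (M.prior i).real (Set.Ioi (x - 1)) := by
    rw [← probReal_compl_eq_one_sub measurableSet_Ioi, Set.compl_Ioi]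
  have h3 : (M.prior i).real (Set.Iic (x - 1)) ≤ (M.prior i).real (Set.Iio x) :=
    measureReal_mono fun z hz => lt_of_le_of_lt (Set.mem_Iic.1 hz) (by linarith)
  linarith

end Model

end RankingSelection

end

theorem proposition2 {N : ℕ} (M : RankingSelection.Problem N) (D : RankingSelection.Design N)
    (hsel : M.SelectsMaxProb D.sel ∨ (M.NormalPriors ∧ M.SelectsMaxMean D.sel))
    (htie : (∀ A : Finset (Fin N), A.Nonempty → (D.tie A).support = A) ∨ D.H ≠ ⊤)
    {Ω : Type*} [MeasurableSpace Ω] (P : Measure Ω) [IsProbabilityMeasure P]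
    (μ : Fin N → Ω → ℝ) (Y : Fin N → ℕ → Ω → ℝ)
    (hmodel : RankingSelection.FollowsModel M P μ Y)
    (hunique : ∀ᵐ ω ∂P, ∃ i, ∀ j, j ≠ i → μ j ω < μ i ω)
    (r : ℕ → ℕ → Ω → D.Rewards) (a : ℕ → ℕ → Ω → Fin N)
    (hroll : RankingSelection.IsRollout M D P μ Y r a)
    (htails : RankingSelection.NondegenerateTails M P Y a)
    (himprove : RankingSelection.ImprovementPossible M D P Y a) :
    ∀ᵐ ω ∂P, ∃ i, (∀ j, j ≠ i → μ j ω < μ i ω) ∧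
      Tendsto (fun T : ℕ => D.sel (RankingSelection.runState Y a T T ω)) atTop (𝓝 i) := by
  have hT := htails.fullTails
  rcases Nat.lt_or_ge 1 N with hN | hN
  · have hc : ∃ c : ℝ, 0 < c ∧ ∀ s, c ≤ M.probBest s (D.sel s) := by
      rcases hsel with h | ⟨hM, h⟩
      · exact h.exists_le
      · exact h.exists_le hM hT
    filter_upwards [hunique, ae_all_iff.2 hmodel.ae_tendsto_average,
      ae_all_iff.2 hmodel.ae_mem_support,
      RankingSelection.ae_tendsto_count hmodel hroll (D.exists_le_stepProb M hN hT hc htie)]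
      with ω ⟨i, hi⟩ havg hsupp hcount
    have hn := hcount (RankingSelection.exists_averagesBounded havg)
    refine ⟨i, hi, ?_⟩
    rw [nhds_discrete, tendsto_pure]
    refine RankingSelection.Problem.eventually_sel_eq hT hsel hsupp hn (fun j => ?_) hi
    simp only [RankingSelection.runState, RankingSelection.stateAfter_mean]
    exact (havg j).comp (hn j)
  · have : Subsingleton (Fin N) := Fin.subsingleton_iff_le_one.2 hN
    filter_upwards [hunique] with ω ⟨i, hi⟩
    refine ⟨i, hi, ?_⟩
    rw [funext fun T : ℕ => Subsingleton.elim (D.sel (RankingSelection.runState Y a T T ω)) i]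
    exact tendsto_const_nhds
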